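/- Let $\Gamma$ be a finite two-player extensive-form game with perfect recall, possibly with chance moves (each of positive probability), with at least one decision node; let $N$ be the number of nodes of its tree. Let $Z$ be the set of terminal nodes, $u_i(z)$ the payoff of player $i$ at $z$, and $p(z)$ the product of the probabilities of the chance moves on the path to $z$. Let $\Sigma_i$ be the set of pairs $(I,a)$ (sequences) of an information set $I$ of player $i$ and an action $a$ at $I$, $\sigma_i(z)$ the last sequence of player $i$ on the path to $z$, and $\Pi_i$ the set of pure reduced-normal-form strategies of player $i$, with subsets $\Pi_i(I)$, $\Pi_i(\sigma)$, $\Pi_i(z)$ of those that can lead to $I$; that can lead to $I$ and prescribe $a$ there, where $\sigma=(I,a)$; and that can lead to $z$. A distribution $\mu$ over $\Pi_1\times\Pi_2$ is an EFCE (extensive-form correlated equilibrium) if following all recommendations is a best response for each player when a device samples $(\pi_1,\pi_2)\sim\mu$ and privately reveals to each player the recommended action at an information set when it is reached, and reveals nothing more to a player once that player has deviated. For $\hat\sigma=(\hat I,\hat a)\in\Sigma_i$ and a distribution $\hat\mu$ over $\Pi_i(\hat I)$, the $(\hat\sigma,\hat\mu)$-trigger agent of player $i$ follows all recommendations, except that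 if $\hat a$ is recommended at $\hat I$, it plays from $\hat I$ on according to a plan sampled from $\hat\mu$. The correlation plan of $\mu$ is the vector $\xi=(\xi_1,\xi_2)$, where for $\sigma\in\Sigma_i$, $z\in Z$, $$\xi_i(\sigma;z)=\Pr_{\pi\sim\mu}\bigl[\pi_i\in\Pi_i(\sigma),\ \pi_{-i}\in\Pi_{-i}(z)\bigr].$$ Let $\mathcal X$ be the set of all correlation plans; $\xi\in\mathcal X$ is called an EFCE if it is the correlation plan of an EFCE. For $\hat\sigma=(\hat I,\hat a)\in\Sigma_i$ let $Y_{i,\hat\sigma}\subset\mathbb R^{\Sigma_i}$ be the set of all $y\ge 0$ such that $\sum_a y(I,a)$ equals, for every information set $I$ of player $i$, the value of $y$ at the last sequence of player $i$ before $I$ (or $1$ if there is none), and $\sum_a y(\hat I,a)=1$. For $\xi$ and $y\in Y_{i,\hat\sigma}$ the trigger value is $$v_{i,\hat\sigma}(\xi,y)=g_{i,\hat\sigma}(\xi,y)-b_{i,\hat\sigma}(\xi),$$ $$g_{i,\hat\sigma}(\xi,y)=\sum_{z\text{ through }\hat I}p(z)u_i(z)\,\xi_i(\hat\sigma;z)\,y(\sigma_i(z)),\qquad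 b_{i,\hat\sigma}(\xi)=\sum_{z\text{ through }\hat\sigma}p(z)u_i(z)\,\xi_i(\sigma_i(z);z),$$ where "through $\hat I$" means that the path to $z$ contains a node of $\hat I$ (with any action there), and "through $\hat\sigma$" that it contains the action $\hat a$ taken at $\hat I$. Let $v^*(\xi)$ be the supremum of $v_{i,\hat\sigma}(\xi,y)$ over $i\in\{1,2\}$, $\hat\sigma\in\Sigma_i$, $y\in Y_{i,\hat\sigma}$. Let $\mathcal Y$ be the set of all $w=(\lambda_{i,\hat\sigma},z_{i,\hat\sigma})_{i,\hat\sigma}$ with $\lambda_{i,\hat\sigma}\in[0,1]$, $\sum_{i,\hat\sigma}\lambda_{i,\hat\sigma}=1$ and $z_{i,\hat\sigma}\in\lambda_{i,\hat\sigma}Y_{i,\hat\sigma}$, and let $$f(\xi,w)=\sum_i\sum_{\hat\sigma\in\Sigma_i}\bigl(g_{i,\hat\sigma}(\xi,z_{i,\hat\sigma})-\lambda_{i,\hat\sigma}b_{i,\hat\sigma}(\xi)\bigr).$$ Then: 1. $\mathcal X$ and $\mathcal Y$ are polytopes, each in a coordinate space of dimension at most $N^2$. Each $Y_{i,\hat\sigma}$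 is a polytope, and equals the set of the vectors $y(\sigma)=\hat\mu(\Pi_i(\sigma))$, where $\hat\mu$ ranges over the distributions over $\Pi_i(\hat I)$. 2. If $\xi$ is the correlation plan of $\mu$ and $y$ is the vector of $\hat\mu$, then $v_{i,\hat\sigma}(\xi,y)$ is the expected utility of the $(\hat\sigma,\hat\mu)$-trigger agent minus the expected utility of player $i$ when following all recommendations. The function $v_{i,\hat\sigma}$ is biaffine: $g_{i,\hat\sigma}(\xi,y)=\xi_i^\top A_{i,\hat\sigma}y$ for a matrix $A_{i,\hat\sigma}$, and $b_{i,\hat\sigma}$ is linear in $\xi_i$. 3. The supremum defining $v^*(\xi)$ is attained, $v^*(\xi)=\max_{w\in\mathcal Y}f(\xi,w)$, and $f$ is bilinear, $f(\xi,w)=\xi^\top Mw$ for a matrix $M$. 4. A distribution $\mu$ is an EFCE if and only if no trigger agent of any player $i$ has a larger expected utility than player $i$ has when following all recommendations, and if and only if $v^*(\xi)\le 0$ for its correlation plan $\xi$. A correlation plan $\xi\in\mathcal X$ is an EFCE if and only if $v^*(\xi)\le0$. 5. An EFCE exists, and $\min_{\xi\in\mathcal X}\max_{w\in\mathcal Y}f(\xi,w)=\min_{\xi\in\mathcal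 X}v^*(\xi)=0$. For $\xi\in\mathcal X$ the following are equivalent: $\xi$ is an EFCE; $\xi$ minimizes $v^*$ over $\mathcal X$; there is $w\in\mathcal Y$ such that $(\xi,w)$ is a saddle point of $f$ on $\mathcal X\times\mathcal Y$ (minimizing in $\xi$, maximizing in $w$). -/

import Mathlib

open scoped BigOperators Pointwise Matrix

universe u v

/-- A finite rooted game tree for two players (indexed by `Fin 2`). `Info i` is the set of
information sets of player `i`, and `Act i I` the set of actions at the information set `I`.
A node is terminal (labelled by the payoffs), a chance node (labelled by the probabilities of its
`n` outgoing edges), or a decision node in the information set `I` of player `i`, whose outgoing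
edges are the actions at `I`. -/
inductive GameTree (Info : Fin 2 → Type u) (Act : ∀ i, Info i → Type v) : Type (max u v) where
  | leaf (payoff : Fin 2 → ℝ) : GameTree Info Act
  | chance (n : ℕ) (p : Fin n → ℝ) (child : Fin n → GameTree Info Act) : GameTree Info Act
  | decision (i : Fin 2) (I : Info i) (child : Act i I → GameTree Info Act) : GameTree Info Act

namespace GameTree

variable {Info : Fin 2 → Type u} {Act : ∀ i, Info i → Type v}

/-- Prepend the move `a` of player `i` at `I` to the pair of own-move lists `h`. -/
def push (i : Fin 2) (I : Info i) (a : Act i I) (h : ∀ j, List (Σ I : Info j, Act j I)) :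
    ∀ j, List (Σ I : Info j, Act j I) :=
  Function.update h i (⟨I, a⟩ :: h i)

/-- `At T h S`: some node of `T` has `S` as the subtree below it, and on the path from the root to
this node each player `j` makes exactly the moves `h j`, in this order (root first). -/
inductive At : GameTree Info Act → (∀ j, List (Σ I : Info j, Act j I)) → GameTree Info Act → Prop
  | here (T : GameTree Info Act) : At T (fun _ => []) T
  | chance {n : ℕ} {p : Fin n → ℝ} {child : Fin n → GameTree Info Act} (k : Fin n)
      {h : ∀ j, List (Σ I : Info j, Act j I)} {S : GameTree Info Act}
      (H : At (child k) h S) : At (.chance n p child) h S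
  | decision {i : Fin 2} {I : Info i} {child : Act i I → GameTree Info Act} (a : Act i I)
      {h : ∀ j, List (Σ I : Info j, Act j I)} {S : GameTree Info Act}
      (H : At (child a) h S) : At (.decision i I child) (push i I a h) S

/-- The number of nodes of the tree. -/
def numNodes [∀ i I, Fintype (Act i I)] : GameTree Info Act → ℕ
  | leaf _ => 1
  | chance _ _ child => 1 + ∑ k, numNodes (child k)
  | decision _ _ child => 1 + ∑ a, numNodes (child a)

/-- The terminal nodes of a tree, each given by its path from the root. -/
def Terminal : GameTree Info Act → Type v
  | leaf _ => PUnit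
  | chance n _ child => Σ k : Fin n, Terminal (child k)
  | decision i I child => Σ a : Act i I, Terminal (child a)

theorem finite_terminal [∀ i I, Fintype (Act i I)] (T : GameTree Info Act) :
    Finite T.Terminal := by
  induction T with
  | leaf _ => exact inferInstanceAs (Finite PUnit)
  | chance n p child ih => exact inferInstanceAs (Finite (Σ k : Fin n, Terminal (child k)))
  | decision i I child ih => exact inferInstanceAs (Finite (Σ a : Act i I, Terminal (child a)))

noncomputable instance [∀ i I, Fintype (Act i I)] (T : GameTree Info Act) : Fintype T.Terminal :=
  haveI := finite_terminal T
  Fintype.ofFinite _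

/-- The payoffs at a terminal node. -/
def payoff : ∀ T : GameTree Info Act, T.Terminal → Fin 2 → ℝ
  | leaf w, _ => w
  | chance _ _ child, z => payoff (child z.1) z.2
  | decision _ _ child, z => payoff (child z.1) z.2

/-- The product of the probabilities of the chance moves on the path to a terminal node. -/
def chanceProb : ∀ T : GameTree Info Act, T.Terminal → ℝ
  | leaf _, _ => 1
  | chance _ p child, z => p z.1 * chanceProb (child z.1) z.2
  | decision _ _ child, z => chanceProb (child z.1) z.2

/-- The moves (information set, action) of each player on the path from the root to a terminal
node, root first. -/
def moves : ∀ T : GameTree Info Act, T.Terminal → ∀ j, List (Σ I : Info j, Act j I)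
  | leaf _, _ => fun _ => []
  | chance _ _ child, z => moves (child z.1) z.2
  | decision i I child, z => push i I z.1 (moves (child z.1) z.2)

end GameTree

/-- A two-player extensive-form game, possibly with chance moves (of positive probability). Every
information set contains at least one node, and there is at least one action at it. -/
structure Game where
  Info : Fin 2 → Type u
  Act : ∀ i, Info i → Type v
  [fintypeInfo : ∀ i, Fintype (Info i)]
  [fintypeAct : ∀ i I, Fintype (Act i I)]
  [nonemptyAct : ∀ i I, Nonempty (Act i I)]
  tree : GameTree Info Act
  chance_pos : ∀ h n p child, tree.At h (.chance n p child) → (∀ k, 0 < p k) ∧ ∑ k, p k = 1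
  info_occurs : ∀ i I, ∃ h child, tree.At h (.decision i I child)

namespace Game

attribute [instance] Game.fintypeInfo Game.fintypeAct Game.nonemptyAct

variable (G : Game.{u, v})

/-- Perfect recall: the paths to any two nodes of the same information set contain the same
sequence of moves of the player who acts there. -/
def PerfectRecall : Prop :=
  ∀ i I h child h' child', G.tree.At h (.decision i I child) →
    G.tree.At h' (.decision i I child') → h i = h' i

/-- The number of nodes of the game tree. -/
abbrev size : ℕ := G.tree.numNodes

/-- `Z`, the terminal states. -/
abbrev Z : Type v := G.tree.Terminal

/-- `Σ_i`, the sequences (information set, action) of player `i`. -/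
abbrev Seq (i : Fin 2) : Type (max u v) := Σ I : G.Info i, G.Act i I

/-- The triggers: pairs of a player `i` and a sequence in `Σ_i`. -/
abbrev Trigger : Type (max u v) := Σ i, G.Seq i

/-- The moves of player `i` on the path from the root to `z`. -/
abbrev own (i : Fin 2) (z : G.Z) : List (G.Seq i) := G.tree.moves z i

/-- `σ_i(z)`: the last sequence of player `i` on the path to `z`, if any. -/
def lastSeq (i : Fin 2) (z : G.Z) : Option (G.Seq i) := (G.own i z).getLast?

/-! ### Reduced-normal-form plans -/

variable {G} in
/-- The (partial) plan `π` prescribes all the moves in `l`. -/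
def Agrees {i : Fin 2} (π : ∀ I : G.Info i, Option (G.Act i I)) (l : List (G.Seq i)) : Prop :=
  ∀ σ ∈ l, π σ.1 = some σ.2

variable {G} in
/-- The plan `π` can lead to the information set `I` (if the other player and chance play to do
so as well). -/
def LeadsTo {i : Fin 2} (π : ∀ I : G.Info i, Option (G.Act i I)) (I : G.Info i) : Prop :=
  ∃ h child, G.tree.At h (.decision i I child) ∧ Agrees π (h i)

/-- `Π_i`: a pure reduced-normal-form plan prescribes an action exactly at those information
sets that it can lead to. -/
def Plan (i : Fin 2) : Type (max u v) :=
  {π : ∀ I : G.Info i, Option (G.Act i I) // ∀ I, (π I).isSome ↔ LeadsTo π I}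

noncomputable instance (i : Fin 2) : Fintype (G.Plan i) :=
  haveI : Finite (G.Plan i) :=
    inferInstanceAs (Finite {π : ∀ I : G.Info i, Option (G.Act i I) //
      ∀ I, (π I).isSome ↔ LeadsTo π I})
  Fintype.ofFinite _

/-- `Π_1 × Π_2`. -/
abbrev Profile : Type (max u v) := ∀ i, G.Plan i

/-- `Π_i(I)`: the plans that can lead to `I`. -/
def PlanTo {i : Fin 2} (I : G.Info i) : Type (max u v) := {π : G.Plan i // LeadsTo π.1 I}

noncomputable instance {i : Fin 2} (I : G.Info i) : Fintype (G.PlanTo I) :=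
  haveI : Finite (G.PlanTo I) := inferInstanceAs (Finite {π : G.Plan i // LeadsTo π.1 I})
  Fintype.ofFinite _

variable {G} in
/-- `π ∈ Π_i(I, a)` for `σ = (I, a)`: the plan can lead to `I` and prescribes `a` at `I`. -/
def Plan.ToSeq {i : Fin 2} (π : G.Plan i) (σ : G.Seq i) : Prop :=
  LeadsTo π.1 σ.1 ∧ π.1 σ.1 = some σ.2

variable {G} in
/-- `π ∈ Π_i(z)`: the plan can lead to the terminal state `z`. -/
def Plan.ToTerminal {i : Fin 2} (π : G.Plan i) (z : G.Z) : Prop := Agrees π.1 (G.own i z)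

/-- Distributions over `Π_1 × Π_2`. -/
abbrev CorrDist : Set (G.Profile → ℝ) := stdSimplex ℝ G.Profile

/-! ### Utilities, trigger agents, and extensive-form correlated equilibrium -/

variable {G} in
open Classical in
/-- The expected utility (over chance) of player `i` when the other player plays according to
`π` and player `i` behaves so that a path is compatible with this behaviour exactly when the list
of moves of player `i` on the path satisfies `B`. -/
noncomputable def util (i : Fin 2) (π : G.Profile) (B : List (G.Seq i) → Prop) : ℝ :=
  ∑ z : G.Z, if B (G.own i z) ∧ ∀ j, j ≠ i → (π j).ToTerminal z
    then G.tree.chanceProb z * G.tree.payoff z i else 0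

variable {G} in
/-- The expected utility of player `i` when both players follow the recommendations `μ`. -/
noncomputable def followUtil (i : Fin 2) (μ : G.Profile → ℝ) : ℝ :=
  ∑ π, μ π * util i π (Agrees (π i).1)

/-- A pure strategy of player `i` in the game extended by the correlation device, which reveals
the recommendation at an information set when it is reached, and reveals nothing more once the
player has deviated. `obey σ` is the action taken on the recommendation `σ = (I, a)` at `I` by a
player who has not deviated before (by perfect recall, `σ` then determines all the
recommendations seen so far); `alone σ J` is the action taken at `J` after the first deviation,
which took place on the recommendation `σ`. -/
structure Deviation (i : Fin 2) where
  obey : ∀ σ : G.Seq i, G.Act i σ.1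
  alone : G.Seq i → ∀ J : G.Info i, G.Act i J

variable {G} in
open Classical in
/-- The moves in the list are those of a player who uses `δ` while `π` is recommended. -/
def Deviation.Plays {i : Fin 2} (δ : G.Deviation i) (π : G.Plan i) : List (G.Seq i) → Prop
  | [] => True
  | σ :: l => ∃ r, π.1 σ.1 = some r ∧ δ.obey ⟨σ.1, r⟩ = σ.2 ∧
      if r = σ.2 then δ.Plays π l else ∀ τ ∈ l, δ.alone ⟨σ.1, r⟩ τ.1 = τ.2

variable {G} in
/-- `μ` is an extensive-form correlated equilibrium: following all recommendations is a best
response of each player among the strategies of the game extended by the device. -/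
def IsEFCE (μ : G.Profile → ℝ) : Prop :=
  ∀ (i : Fin 2) (δ : G.Deviation i), ∑ π, μ π * util i π (δ.Plays (π i)) ≤ followUtil i μ

variable {G} in
open Classical in
/-- The moves in the list are those of a trigger agent with trigger `s = (Î, â)` when `π` is
recommended and `ρ` is the plan sampled for the deviation: the agent follows `π`, but if `â` is
recommended at `Î`, it plays `ρ` from there on (including the move at `Î`). -/
def TriggerPlays {i : Fin 2} (s : G.Seq i) (π ρ : G.Plan i) : List (G.Seq i) → Prop
  | [] => True
  | σ :: l => if σ.1 = s.1 ∧ π.1 s.1 = some s.2 then Agrees ρ.1 (σ :: l)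
      else π.1 σ.1 = some σ.2 ∧ TriggerPlays s π ρ l

variable {G} in
/-- The expected utility of the `(s, ν)`-trigger agent of player `i`, where `ν` is a distribution
over the plans that can lead to the information set of `s`. -/
noncomputable def triggerUtil (i : Fin 2) (s : G.Seq i) (μ : G.Profile → ℝ)
    (ν : G.PlanTo s.1 → ℝ) : ℝ :=
  ∑ π, ∑ ρ, μ π * ν ρ * util i π (TriggerPlays s (π i) ρ.1)

/-! ### Correlation plans and sequence-form deviations -/

/-- The coordinates of a correlation plan: `ξ ⟨⟨i, σ⟩, z⟩` stands for `ξ_i(σ; z)`. -/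
abbrev XIdx : Type (max u v) := G.Trigger × G.Z

variable {G} in
open Classical in
/-- The correlation plan of `μ`: `ξ_i(σ; z)` is the probability that the plan of player `i` is in
`Π_i(σ)` and the plan of the other player can lead to `z`. -/
noncomputable def corrPlan (μ : G.Profile → ℝ) : G.XIdx → ℝ := fun x =>
  ∑ π, if (π x.1.1).ToSeq x.1.2 ∧ ∀ j, j ≠ x.1.1 → (π j).ToTerminal x.2 then μ π else 0

/-- `𝒳`, the set of correlation plans. -/
def X : Set (G.XIdx → ℝ) := corrPlan '' G.CorrDist

variable {G} in
/-- The correlation plan `ξ` is an EFCE: it is the correlation plan of an EFCE. -/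
def IsEFCEPlan (ξ : G.XIdx → ℝ) : Prop := ∃ μ ∈ G.CorrDist, corrPlan μ = ξ ∧ IsEFCE μ

/-- `Y_{i,s}` for the trigger `s = (Î, â)`: the sequence-form polytope of player `i`, restricted
to the strategies that reach `Î` with probability one as far as player `i` is concerned. At
every information set `I` the values of the sequences at `I` sum to the value of the last
sequence before `I`, or to `1` if there is none. -/
def SeqForm {i : Fin 2} (s : G.Seq i) : Set (G.Seq i → ℝ) :=
  {y | (∀ σ, 0 ≤ y σ) ∧
    (∀ I h child, G.tree.At h (.decision i I child) →
      ∑ a, y ⟨I, a⟩ = ((h i).getLast?).elim 1 y) ∧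
    ∑ a, y ⟨s.1, a⟩ = 1}

variable {G} in
open Classical in
/-- The sequence-form vector of a distribution over `Π_i(I)`: the value at `σ` is the probability
of `Π_i(σ)`. -/
noncomputable def seqOf {i : Fin 2} {I : G.Info i} (ν : G.PlanTo I → ℝ) : G.Seq i → ℝ :=
  fun σ => ∑ ρ, if ρ.1.ToSeq σ then ν ρ else 0

/-! ### The saddle-point problem -/

variable {G} in
open Classical in
/-- The deviation term `∑ u_i(z) ξ_i(s; z) y(z)`, over the terminal states `z` whose path passes
through the information set of `s`; here `y(z) = y(σ_i(z))`, and the payoffs are weighted by the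
chance probabilities. -/
noncomputable def gain {i : Fin 2} (s : G.Seq i) (ξ : G.XIdx → ℝ) (y : G.Seq i → ℝ) : ℝ :=
  ∑ z : G.Z, if ∃ a, (⟨s.1, a⟩ : G.Seq i) ∈ G.own i z
    then G.tree.chanceProb z * G.tree.payoff z i * ξ (⟨i, s⟩, z) * (G.lastSeq i z).elim 0 y else 0

variable {G} in
open Classical in
/-- The term `∑ u_i(z) ξ_i(σ_i(z); z)`, over the terminal states `z` whose path contains the
sequence `s`. -/
noncomputable def base {i : Fin 2} (s : G.Seq i) (ξ : G.XIdx → ℝ) : ℝ :=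
  ∑ z : G.Z, if s ∈ G.own i z
    then G.tree.chanceProb z * G.tree.payoff z i *
      (G.lastSeq i z).elim 0 (fun σ => ξ (⟨i, σ⟩, z)) else 0

variable {G} in
/-- The trigger value `v_{i,s}(ξ, y)`. -/
noncomputable def triggerValue {i : Fin 2} (s : G.Seq i) (ξ : G.XIdx → ℝ) (y : G.Seq i → ℝ) : ℝ :=
  gain s ξ y - base s ξ

variable {G} in
/-- The values of all deviations against `ξ`. -/
def deviationValues (ξ : G.XIdx → ℝ) : Set ℝ :=
  {r | ∃ (i : Fin 2) (s : G.Seq i), ∃ y ∈ G.SeqForm s, r = triggerValue s ξ y}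

variable {G} in
/-- `v*(ξ)`. -/
noncomputable def vStar (ξ : G.XIdx → ℝ) : ℝ := sSup (deviationValues ξ)

/-- The coordinates of `(λ, z)`: one multiplier `λ_{i,s}` for each trigger, and, for each trigger,
a vector `z_{i,s}` indexed by the sequences of player `i`. -/
abbrev YIdx : Type (max u v) := G.Trigger ⊕ (Σ i, G.Seq i × G.Seq i)

variable {G} in
/-- The multiplier `λ_{i,s}`. -/
def lam (w : G.YIdx → ℝ) (i : Fin 2) (s : G.Seq i) : ℝ := w (Sum.inl ⟨i, s⟩)

variable {G} in
/-- The vector `z_{i,s}`. -/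
def zvec (w : G.YIdx → ℝ) (i : Fin 2) (s : G.Seq i) : G.Seq i → ℝ :=
  fun τ => w (Sum.inr ⟨i, (s, τ)⟩)

/-- `𝒴`: the multipliers are in `[0, 1]` and sum to one, and `z_{i,s} ∈ λ_{i,s} Y_{i,s}`. -/
def Y : Set (G.YIdx → ℝ) :=
  {w | (∀ i s, lam w i s ∈ Set.Icc (0 : ℝ) 1) ∧
    ∑ i, ∑ s, lam w i s = 1 ∧
    ∀ i s, zvec w i s ∈ lam w i s • G.SeqForm s}

variable {G} in
/-- The objective of the saddle-point problem. -/
noncomputable def objective (ξ : G.XIdx → ℝ) (w : G.YIdx → ℝ) : ℝ :=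
  ∑ i, ∑ s, (gain s ξ (zvec w i s) - lam w i s * base s ξ)

end Game

/-- A polytope is the convex hull of a finite set of points. -/
def IsPolytope {ι : Type*} (S : Set (ι → ℝ)) : Prop :=
  ∃ V : Set (ι → ℝ), V.Finite ∧ S = convexHull ℝ V

/-! By perfect recall the own moves on the path to a node are determined by its information set,
so the sequence-form vectors are exactly those of the mixed plans: choose an action independently
at every information set, with the conditional probabilities that the vector prescribes (Kuhn).

A deviation in the extended game leaves the recommendations for the first time at a definite
information set, where it behaves like a trigger agent. Its gain is therefore the sum of the gains
of trigger agents, which reduces EFCEs to the inequality `v* ≤ 0`. Conversely a trigger agent is a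
rule that replaces the recommended plan by another one. Hence an EFCE exists by the argument of
Hart and Schmeidler: by the minimax theorem it suffices to find a correlated strategy that makes a
given mixture of such rules unprofitable, and the product of the stationary distributions of the
two Markov chains on plans that the mixture induces does so.

A trigger agent at a last information set of a player that plays the action it was recommended
gains nothing at any correlation plan, so `v*` is nonnegative and the optimal value is zero.
-/

section Indicator

variable {p q : Prop}

open Classical in
/-- The Iverson bracket of a proposition, which turns probabilities of events under finite
distributions into weighted sums. -/
noncomputable def ind (p : Prop) : ℝ := if p then 1 else 0

theorem ind_of (h : p) : ind p = 1 := if_pos h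

theorem ind_of_not (h : ¬ p) : ind p = 0 := if_neg h

theorem ind_and : ind (p ∧ q) = ind p * ind q := by
  by_cases hp : p <;> by_cases hq : q <;> simp [ind, hp, hq]

theorem ind_nonneg (p : Prop) : 0 ≤ ind p := by
  rw [ind]
  split_ifs <;> norm_num

theorem ind_le_one (p : Prop) : ind p ≤ 1 := by
  rw [ind]
  split_ifs <;> norm_num

theorem ite_eq_mul_ind (p : Prop) [Decidable p] (a : ℝ) : (if p then a else 0) = a * ind p := by
  by_cases h : p <;> simp [h, ind]

theorem option_elim_eq_sum_ind {κ : Type*} [Fintype κ] (o : Option κ) (f : κ → ℝ) :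
    o.elim 0 f = ∑ k, ind (o = some k) * f k := by
  classical
  cases o <;> simp [ind]

end Indicator

/-! ### Simplices and polytopes -/

section Simplex

variable {κ τ ι : Type*} [Fintype κ] [Fintype τ]

theorem isPolytope_image_stdSimplex {F : (κ → ℝ) → ι → ℝ} (hF : IsLinearMap ℝ F) :
    IsPolytope (F '' stdSimplex ℝ κ) := by
  classical
  refine ⟨F '' Set.range fun k : κ => Pi.single k (1 : ℝ), (Set.finite_range _).image _, ?_⟩
  rw [← hF.image_convexHull, convexHull_rangle_single_eq_stdSimplex]

theorem IsPolytope.isCompact [Finite ι] {S : Set (ι → ℝ)} (h : IsPolytope S) : IsCompact S := by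
  have := Fintype.ofFinite ι
  obtain ⟨V, hV, rfl⟩ := h
  exact hV.isCompact_convexHull ℝ

theorem sum_mul_le_of_mem_stdSimplex {x f : κ → ℝ} {c : ℝ} (hx : x ∈ stdSimplex ℝ κ)
    (hf : ∀ k, f k ≤ c) : ∑ k, x k * f k ≤ c :=
  calc ∑ k, x k * f k ≤ ∑ k, x k * c :=
        Finset.sum_le_sum fun k _ => mul_le_mul_of_nonneg_left (hf k) (hx.1 k)
    _ = c := by rw [← Finset.sum_mul, hx.2, one_mul]

theorem exists_mem_stdSimplex_sum_mul_eq_sum_mul_comp (φ : κ → τ) {x : κ → ℝ}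
    (hx : x ∈ stdSimplex ℝ κ) :
    ∃ y ∈ stdSimplex ℝ τ, ∀ f : τ → ℝ, ∑ t, y t * f t = ∑ k, x k * f (φ k) := by
  classical
  have hsum (f : τ → ℝ) : ∑ t, (∑ k, if φ k = t then x k else 0) * f t = ∑ k, x k * f (φ k) := by
    simp only [Finset.sum_mul, ite_mul, zero_mul]
    rw [Finset.sum_comm]
    simp only [Finset.sum_ite_eq, Finset.mem_univ, if_true]
  refine ⟨_, ⟨fun t => Finset.sum_nonneg fun k _ => ?_, ?_⟩, hsum⟩
  · exact ite_nonneg (hx.1 k) le_rfl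
  · simpa [hx.2] using hsum fun _ => 1

theorem eq_zero_of_sum_mul_ind_eq_one {x : κ → ℝ} (hx : x ∈ stdSimplex ℝ κ) {p : κ → Prop}
    (hp : ∑ k, x k * ind (p k) = 1) {k : κ} (hk : ¬ p k) : x k = 0 := by
  have hdefect : ∑ k, x k * (1 - ind (p k)) = 0 := by
    simp only [mul_sub, mul_one, Finset.sum_sub_distrib, hx.2, hp, sub_self]
  have hzero := (Finset.sum_eq_zero_iff_of_nonneg fun k _ =>
    mul_nonneg (hx.1 k) (sub_nonneg.2 (ind_le_one _))).1 hdefect k (Finset.mem_univ k)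
  simpa [ind_of_not hk] using hzero

theorem exists_mem_stdSimplex_eq_sum_mul [Nonempty κ] {v : κ → ℝ} (hv : ∀ k, 0 ≤ v k) :
    ∃ x ∈ stdSimplex ℝ κ, ∀ k, v k = (∑ j, v j) * x k := by
  classical
  rcases eq_or_ne (∑ j, v j) 0 with h | h
  · refine ⟨_, single_mem_stdSimplex ℝ (Classical.arbitrary κ), fun k => ?_⟩
    rw [h, zero_mul]
    exact (Finset.sum_eq_zero_iff_of_nonneg fun j _ => hv j).1 h k (Finset.mem_univ k)
  · refine ⟨fun k => v k / ∑ j, v j, ⟨fun k => ?_, ?_⟩, fun k => (mul_div_cancel₀ _ h).symm⟩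
    · exact div_nonneg (hv k) (Finset.sum_nonneg fun j _ => hv j)
    · rw [← Finset.sum_div, div_self h]

theorem mem_stdSimplex_sigma_iff {S : κ → Type*} [∀ t, Fintype (S t)] [∀ t, Nonempty (S t)]
    {x : (Σ t, S t) → ℝ} :
    x ∈ stdSimplex ℝ (Σ t, S t) ↔ ∃ l ∈ stdSimplex ℝ κ, ∃ ν : ∀ t, S t → ℝ,
      (∀ t, ν t ∈ stdSimplex ℝ (S t)) ∧ x = fun p => l p.1 * ν p.1 p.2 := by
  constructor
  · intro hx
    choose ν hν hxν using fun t =>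
      exists_mem_stdSimplex_eq_sum_mul fun k : S t => hx.1 ⟨t, k⟩
    exact ⟨fun t => ∑ k, x ⟨t, k⟩, ⟨fun t => Finset.sum_nonneg fun k _ => hx.1 _,
      (Fintype.sum_sigma x).symm.trans hx.2⟩, ν, hν, funext fun p => hxν p.1 p.2⟩
  · rintro ⟨l, hl, ν, hν, rfl⟩
    refine ⟨fun p => mul_nonneg (hl.1 p.1) ((hν p.1).1 p.2), ?_⟩
    simp only [Fintype.sum_sigma, ← Finset.mul_sum, (hν _).2, mul_one, hl.2]

theorem exists_matrix_eq_dotProduct_mulVec {B : (κ → ℝ) → (τ → ℝ) → ℝ}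
    (hleft : ∀ y, IsLinearMap ℝ fun x => B x y) (hright : ∀ x, IsLinearMap ℝ (B x)) :
    ∃ M : Matrix κ τ ℝ, ∀ x y, B x y = x ⬝ᵥ (M *ᵥ y) := by
  classical
  let b := LinearMap.mk₂ ℝ B (fun x x' y => (hleft y).map_add x x')
    (fun c x y => (hleft y).map_smul c x) (fun x y y' => (hright x).map_add y y')
    (fun c x y => (hright x).map_smul c y)
  refine ⟨LinearMap.toMatrix₂' ℝ b, fun x y => ?_⟩
  rw [← Matrix.toLinearMap₂'_apply', Matrix.toLinearMap₂'_toMatrix', LinearMap.mk₂_apply]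

end Simplex

section Product

variable {ι : Type*} [Fintype ι] [DecidableEq ι] {S : ι → Type*} [∀ i, Fintype (S i)]

theorem sum_prod_eq_one {x : ∀ i, S i → ℝ} (hx : ∀ i, ∑ k, x i k = 1) :
    ∑ π : ∀ i, S i, ∏ i, x i (π i) = 1 := by
  rw [← Fintype.piFinset_univ, ← Finset.prod_univ_sum]
  simp only [hx, Finset.prod_const_one]

theorem prod_mem_stdSimplex {x : ∀ i, S i → ℝ} (hx : ∀ i, x i ∈ stdSimplex ℝ (S i)) :
    (fun π => ∏ i, x i (π i)) ∈ stdSimplex ℝ (∀ i, S i) :=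
  ⟨fun π => Finset.prod_nonneg fun i _ => (hx i).1 (π i), sum_prod_eq_one fun i => (hx i).2⟩

theorem sum_prod_mul_eq_sum_prod_mul_sum_update {x : ∀ i, S i → ℝ} {i : ι}
    (hx : ∑ k, x i k = 1) (F : (∀ i, S i) → ℝ) :
    ∑ π, (∏ j, x j (π j)) * F π =
      ∑ π, (∏ j, x j (π j)) * ∑ k, x i k * F (Function.update π i k) := by
  let swap : (∀ j, S j) × S i → (∀ j, S j) × S i := fun q => (Function.update q.1 i q.2, q.1 i)
  have swap_swap : Function.Involutive swap := fun q => by simp [swap]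
  have hprod : ∀ q, (∏ j, x j ((swap q).1 j)) * x i (swap q).2 =
      (∏ j, x j (q.1 j)) * x i q.2 := fun q => by
    rw [← Finset.mul_prod_erase _ _ (Finset.mem_univ i),
      ← Finset.mul_prod_erase _ (fun j => x j (q.1 j)) (Finset.mem_univ i),
      Finset.prod_congr rfl fun j hj => by
        rw [show (swap q).1 j = q.1 j from Function.update_of_ne (Finset.ne_of_mem_erase hj) _ _]]
    simp only [swap, Function.update_self]
    ring
  calc ∑ π, (∏ j, x j (π j)) * F π
      = ∑ q : (∀ j, S j) × S i, (∏ j, x j (q.1 j)) * x i q.2 * F q.1 := by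
        simp only [Fintype.sum_prod_type, mul_right_comm _ (x i _), ← Finset.mul_sum, hx, mul_one]
    _ = ∑ q : (∀ j, S j) × S i, (∏ j, x j (q.1 j)) * x i q.2 * F (swap q).1 :=
        (Equiv.sum_comp swap_swap.toPerm _).symm.trans <| Finset.sum_congr rfl fun q _ =>
          congrArg (· * F (swap q).1) (hprod q)
    _ = _ := by simp only [Fintype.sum_prod_type, mul_assoc, ← Finset.mul_sum, swap]

open Classical in
theorem sum_ite_prod_eq_prod {b : ∀ i, S i → ℝ} (hb : ∀ i, ∑ a, b i a = 1)
    {L : Finset (Σ i, S i)} (hL : Set.InjOn Sigma.fst (L : Set (Σ i, S i))) :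
    (∑ f : ∀ i, S i, if ∀ σ ∈ L, f σ.1 = σ.2 then ∏ i, b i (f i) else 0) =
      ∏ σ ∈ L, b σ.1 σ.2 := by
  have hmem : ∀ σ ∈ L, ∀ a, (∀ τ ∈ L, τ.1 = σ.1 → τ = ⟨σ.1, a⟩) ↔ a = σ.2 := fun σ hσ a =>
    ⟨fun h => (eq_of_heq (Sigma.mk.inj_iff.1 (h σ hσ rfl)).2).symm,
      fun h τ hτ e => h ▸ hL hτ hσ e⟩
  calc (∑ f : ∀ i, S i, if ∀ σ ∈ L, f σ.1 = σ.2 then ∏ i, b i (f i) else 0)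
      = ∑ f : ∀ i, S i, ∏ i, if ∀ τ ∈ L, τ.1 = i → τ = ⟨i, f i⟩ then b i (f i) else 0 := by
        refine Finset.sum_congr rfl fun f _ => ?_
        split_ifs with h
        · refine Finset.prod_congr rfl fun i _ => (if_pos ?_).symm
          rintro τ hτ rfl
          exact Sigma.ext rfl (heq_of_eq (h τ hτ).symm)
        · obtain ⟨σ, hσ, hne⟩ : ∃ σ ∈ L, f σ.1 ≠ σ.2 := by simpa using h
          exact (Finset.prod_eq_zero (Finset.mem_univ σ.1)
            (if_neg (mt (hmem σ hσ _).1 hne))).symm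
    _ = ∏ i, ∑ a, if ∀ τ ∈ L, τ.1 = i → τ = ⟨i, a⟩ then b i a else 0 := by
        rw [Finset.prod_univ_sum, Fintype.piFinset_univ]
    _ = ∏ i ∈ L.image Sigma.fst, ∑ a, if ∀ τ ∈ L, τ.1 = i → τ = ⟨i, a⟩ then b i a else 0 := by
        refine (Finset.prod_subset (Finset.subset_univ _) fun i _ hi => ?_).symm
        rw [← hb i]
        exact Finset.sum_congr rfl fun a _ =>
          if_pos fun τ hτ e => absurd (Finset.mem_image.2 ⟨τ, hτ, e⟩) hi
    _ = ∏ σ ∈ L, b σ.1 σ.2 := by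
        rw [Finset.prod_image hL]
        refine Finset.prod_congr rfl fun σ hσ => ?_
        simp only [hmem σ hσ, Finset.sum_ite_eq', Finset.mem_univ, if_true]

end Product

/-! ### Stationary distributions and correlated equilibria -/

section Minimax

variable {κ τ : Type*} [Fintype κ] [Fintype τ]

theorem exists_mem_stdSimplex_vecMul_nonpos [Nonempty κ] (A : Matrix κ τ ℝ)
    (h : ∀ c ∈ stdSimplex ℝ τ, ∃ x ∈ stdSimplex ℝ κ, x ⬝ᵥ A *ᵥ c ≤ 0) :
    ∃ x ∈ stdSimplex ℝ κ, ∀ t, (x ᵥ* A) t ≤ 0 := by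
  classical
  obtain ⟨x₀, hx₀⟩ : (stdSimplex ℝ κ).Nonempty := Set.nonempty_coe_sort.1 inferInstance
  cases isEmpty_or_nonempty τ with
  | inl hτ => exact ⟨x₀, hx₀, hτ.elim⟩
  | inr hτ =>
    obtain ⟨x, hx, c, hc, hxc⟩ := Sion.exists_isSaddlePointOn (X := stdSimplex ℝ κ)
      (Y := stdSimplex ℝ τ) (f := fun x c => x ⬝ᵥ A *ᵥ c)
      ⟨x₀, hx₀⟩ (convex_stdSimplex ℝ κ) (isCompact_stdSimplex ℝ κ)
      (fun c _ => (Continuous.lowerSemicontinuous (by fun_prop)).lowerSemicontinuousOn _)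
      (fun c _ => ConvexOn.quasiconvexOn ⟨convex_stdSimplex ℝ κ, fun x _ y _ a b _ _ _ =>
        by simp [add_dotProduct]⟩)
      (convex_stdSimplex ℝ τ) (Set.nonempty_coe_sort.1 inferInstance) (isCompact_stdSimplex ℝ τ)
      (fun x _ => (Continuous.upperSemicontinuous (by fun_prop)).upperSemicontinuousOn _)
      (fun x _ => ConcaveOn.quasiconcaveOn ⟨convex_stdSimplex ℝ τ, fun c _ d _ a b _ _ _ =>
        by simp [Matrix.mulVec_add, Matrix.mulVec_smul, dotProduct_add]⟩)
    obtain ⟨x', hx', hle⟩ := h c hc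
    refine ⟨x, hx, fun t => ?_⟩
    calc (x ᵥ* A) t = x ⬝ᵥ A *ᵥ Pi.single t 1 := by
          rw [Matrix.dotProduct_mulVec, dotProduct_single_one]
      _ ≤ x' ⬝ᵥ A *ᵥ c := hxc x' hx' (Pi.single t 1) (single_mem_stdSimplex ℝ t)
      _ ≤ 0 := hle

theorem exists_mem_stdSimplex_vecMul_eq_zero [Nonempty κ] {Q : Matrix κ κ ℝ}
    (hQ : ∀ k q, k ≠ q → 0 ≤ Q k q) (hsum : ∀ k, ∑ q, Q k q = 0) :
    ∃ x ∈ stdSimplex ℝ κ, x ᵥ* Q = 0 := by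
  classical
  obtain ⟨x, hx, hle⟩ := exists_mem_stdSimplex_vecMul_nonpos Q fun c _ => by
    obtain ⟨k₀, hk₀⟩ := Finite.exists_max c
    refine ⟨Pi.single k₀ 1, single_mem_stdSimplex ℝ k₀, ?_⟩
    calc Pi.single k₀ 1 ⬝ᵥ Q *ᵥ c = ∑ q, Q k₀ q * (c q - c k₀) := by
          rw [single_one_dotProduct]
          simp [mul_sub, Finset.sum_sub_distrib, ← Finset.sum_mul, hsum, Matrix.mulVec, dotProduct]
      _ ≤ 0 := Finset.sum_nonpos fun q _ => by
          rcases eq_or_ne k₀ q with rfl | hq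
          · simp
          · exact mul_nonpos_of_nonneg_of_nonpos (hQ k₀ q hq) (sub_nonpos.2 (hk₀ q))
  refine ⟨x, hx, funext fun q => ?_⟩
  have htotal : ∑ q, (x ᵥ* Q) q = 0 := by
    simp only [Matrix.vecMul, dotProduct]
    rw [Finset.sum_comm]
    simp only [← Finset.mul_sum, hsum, mul_zero, Finset.sum_const_zero]
  exact (Finset.sum_eq_zero_iff_of_nonpos fun q _ => hle q).1 htotal q (Finset.mem_univ q)

theorem exists_mem_stdSimplex_sum_apply_sub_eq_zero [Nonempty κ] (φ : τ → κ → κ) {c : τ → ℝ}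
    (hc : ∀ t, 0 ≤ c t) :
    ∃ x ∈ stdSimplex ℝ κ, ∀ g : κ → ℝ, ∑ k, x k * ∑ t, c t * (g (φ t k) - g k) = 0 := by
  classical
  let Q : Matrix κ κ ℝ := fun k q =>
    ∑ t, c t * ((Pi.single (φ t k) 1 : κ → ℝ) q - (Pi.single k 1 : κ → ℝ) q)
  have hQ : ∀ (g : κ → ℝ) k, (Q *ᵥ g) k = ∑ t, c t * (g (φ t k) - g k) := fun g k => by
    simp only [Q, Matrix.mulVec, dotProduct, Finset.sum_mul]
    rw [Finset.sum_comm]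
    simp [mul_assoc, ← Finset.mul_sum, sub_mul, Pi.single_apply]
  obtain ⟨x, hx, hxQ⟩ := exists_mem_stdSimplex_vecMul_eq_zero (Q := Q)
    (fun k q hkq => Finset.sum_nonneg fun t _ => mul_nonneg (hc t) (by
      rw [Pi.single_eq_of_ne hkq.symm, sub_zero]
      exact (Pi.single_nonneg.2 zero_le_one : (0 : κ → ℝ) ≤ Pi.single _ 1) q))
    (fun k => by simpa [Matrix.mulVec, dotProduct] using hQ (fun _ => 1) k)
  refine ⟨x, hx, fun g => ?_⟩
  calc ∑ k, x k * ∑ t, c t * (g (φ t k) - g k) = x ⬝ᵥ Q *ᵥ g := by simp only [dotProduct, hQ]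
    _ = 0 := by rw [Matrix.dotProduct_mulVec, hxQ, zero_dotProduct]

/-- Hart and Schmeidler: against any mixture of deviations, the product of stationary
distributions of the players' deviation dynamics makes the total gain vanish; minimax does the
rest. -/
theorem exists_correlatedEquilibrium {ι : Type*} [Fintype ι] [DecidableEq ι] {S : ι → Type*}
    [∀ i, Fintype (S i)] [∀ i, Nonempty (S i)] (u : ι → (∀ i, S i) → ℝ) :
    ∃ μ ∈ stdSimplex ℝ (∀ i, S i), ∀ i (φ : S i → S i),
      ∑ π, μ π * u i (Function.update π i (φ (π i))) ≤ ∑ π, μ π * u i π := by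
  classical
  let A : Matrix (∀ i, S i) (Σ i, S i → S i) ℝ := fun π d =>
    u d.1 (Function.update π d.1 (d.2 (π d.1))) - u d.1 π
  obtain ⟨μ, hμ, hle⟩ := exists_mem_stdSimplex_vecMul_nonpos A fun c hc => by
    choose x hx hstat using fun i => exists_mem_stdSimplex_sum_apply_sub_eq_zero
      (fun φ : S i → S i => φ) (c := fun φ => c ⟨i, φ⟩) fun φ => hc.1 _
    refine ⟨_, prod_mem_stdSimplex hx, le_of_eq ?_⟩
    simp only [dotProduct, Matrix.mulVec, Fintype.sum_sigma, A, Finset.mul_sum]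
    rw [Finset.sum_comm]
    refine Finset.sum_eq_zero fun i _ => ?_
    simp only [← Finset.mul_sum]
    rw [sum_prod_mul_eq_sum_prod_mul_sum_update (hx i).2]
    refine Finset.sum_eq_zero fun π _ => mul_eq_zero_of_right _ ?_
    simpa [mul_comm (c _)] using hstat i fun k => u i (Function.update π i k)
  refine ⟨μ, hμ, fun i φ => sub_nonpos.1 ?_⟩
  simpa [A, Matrix.vecMul, dotProduct, mul_sub] using hle ⟨i, φ⟩

end Minimax

/-! ### The size of a game tree -/

namespace GameTree

variable {Info : Fin 2 → Type u} {Act : ∀ i, Info i → Type v}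

theorem push_self (i : Fin 2) (I : Info i) (a : Act i I) (h : ∀ j, List (Σ I : Info j, Act j I)) :
    push i I a h i = ⟨I, a⟩ :: h i :=
  Function.update_self ..

theorem push_of_ne {i j : Fin 2} (hij : j ≠ i) (I : Info i) (a : Act i I)
    (h : ∀ j, List (Σ I : Info j, Act j I)) : push i I a h j = h j :=
  Function.update_of_ne hij ..

theorem at_moves (T : GameTree Info Act) (z : T.Terminal) : ∃ w, T.At (T.moves z) (.leaf w) := by
  induction T with
  | leaf w => exact ⟨w, .here _⟩
  | chance n p child ih =>
    obtain ⟨w, H⟩ := ih z.1 z.2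
    exact ⟨w, .chance z.1 H⟩
  | decision i I child ih =>
    obtain ⟨w, H⟩ := ih z.1 z.2
    exact ⟨w, .decision z.1 H⟩

theorem At.exists_at_decision_of_eq_append_cons {T S : GameTree Info Act}
    {h : ∀ j, List (Σ I : Info j, Act j I)} (H : At T h S) {i : Fin 2}
    {l l' : List (Σ I : Info i, Act i I)} {σ : Σ I : Info i, Act i I} (e : h i = l ++ σ :: l') :
    ∃ h' child, At T h' (.decision i σ.1 child) ∧ h' i = l := by
  induction H generalizing l with
  | here T => simp at e
  | chance k _ ih =>
    obtain ⟨h', child, H', e'⟩ := ih e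
    exact ⟨h', child, .chance k H', e'⟩
  | @decision j I child a h S H ih =>
    rcases eq_or_ne i j with rfl | hij
    · rw [push_self] at e
      cases l with
      | nil =>
        obtain ⟨rfl, -⟩ := List.cons.inj e
        exact ⟨_, child, .here _, rfl⟩
      | cons τ l =>
        obtain ⟨rfl, htail⟩ := List.cons.inj e
        obtain ⟨h', child', H', e'⟩ := ih htail
        exact ⟨_, child', .decision a H', by rw [push_self, e']⟩
    · rw [push_of_ne hij] at e
      obtain ⟨h', child', H', e'⟩ := ih e
      exact ⟨_, child', .decision a H', by rw [push_of_ne hij, e']⟩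

variable [∀ i I, Fintype (Act i I)]

theorem card_terminal_le (T : GameTree Info Act) : Fintype.card T.Terminal ≤ T.numNodes := by
  rw [← Nat.card_eq_fintype_card]
  induction T with
  | leaf _ => exact (Nat.card_unique (α := PUnit)).le
  | chance n p child ih =>
    calc Nat.card (chance n p child).Terminal = ∑ k, Nat.card (child k).Terminal :=
          Nat.card_sigma (β := fun k => (child k).Terminal)
      _ ≤ _ := (Finset.sum_le_sum fun k _ => ih k).trans (Nat.le_add_left _ _)
  | decision i I child ih =>
    calc Nat.card (decision i I child).Terminal = ∑ a, Nat.card (child a).Terminal :=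
          Nat.card_sigma (β := fun a => (child a).Terminal)
      _ ≤ _ := (Finset.sum_le_sum fun a _ => ih a).trans (Nat.le_add_left _ _)

open Classical in
theorem exists_finset_card_lt_numNodes (T : GameTree Info Act) :
    ∃ s : Finset (Σ i, Σ I : Info i, Act i I), s.card < T.numNodes ∧
      ∀ i I h child, T.At h (.decision i I child) → ∀ a, ⟨i, I, a⟩ ∈ s := by
  induction T with
  | leaf w => exact ⟨∅, by simp [numNodes], fun i I h child H => by cases H⟩
  | chance n p child ih =>
    choose s hs hmem using ih
    refine ⟨Finset.univ.biUnion s, ?_, fun i I h child H a => ?_⟩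
    · rw [numNodes, add_comm, Nat.lt_succ_iff]
      exact Finset.card_biUnion_le.trans (Finset.sum_le_sum fun k _ => (hs k).le)
    · cases H with
      | chance k H => exact Finset.mem_biUnion.2 ⟨k, Finset.mem_univ _, hmem k i I _ _ H a⟩
  | decision j J child ih =>
    choose s hs hmem using ih
    refine ⟨Finset.univ.image (fun a : Act j J => ⟨j, J, a⟩) ∪ Finset.univ.biUnion s, ?_,
      fun i I h child H a => ?_⟩
    · rw [numNodes, add_comm, Nat.lt_succ_iff]
      calc _ ≤ Fintype.card (Act j J) + ∑ a, (s a).card :=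
            (Finset.card_union_le _ _).trans
              (Nat.add_le_add Finset.card_image_le Finset.card_biUnion_le)
        _ = ∑ a, ((s a).card + 1) := by simp [Finset.sum_add_distrib, add_comm]
        _ ≤ ∑ a, numNodes (child a) := Finset.sum_le_sum fun a _ => hs a
    · cases H with
      | here => exact Finset.mem_union_left _ (Finset.mem_image_of_mem _ (Finset.mem_univ a))
      | decision b H =>
        exact Finset.mem_union_right _
          (Finset.mem_biUnion.2 ⟨b, Finset.mem_univ _, hmem b i I _ _ H a⟩)

end GameTree

namespace Game

variable {G : Game.{u, v}} {i : Fin 2}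

theorem card_trigger_lt_size (G : Game.{u, v}) : Fintype.card G.Trigger < G.size := by
  obtain ⟨s, hs, hmem⟩ := G.tree.exists_finset_card_lt_numNodes
  refine lt_of_le_of_lt (Finset.card_le_card fun t _ => ?_) hs
  obtain ⟨h, child, H⟩ := G.info_occurs t.1 t.2.1
  exact hmem t.1 t.2.1 h child H t.2.2

theorem card_xIdx_le (G : Game.{u, v}) : Fintype.card G.XIdx ≤ G.size ^ 2 := by
  rw [Fintype.card_prod, sq]
  exact Nat.mul_le_mul G.card_trigger_lt_size.le G.tree.card_terminal_le

theorem card_yIdx_le (G : Game.{u, v}) : Fintype.card G.YIdx ≤ G.size ^ 2 := by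
  have hcard := G.card_trigger_lt_size
  rw [Fintype.card_sigma, Fin.sum_univ_two] at hcard
  rw [Fintype.card_sum, Fintype.card_sigma, Fintype.card_sigma, Fin.sum_univ_two,
    Fin.sum_univ_two, Fintype.card_prod, Fintype.card_prod]
  nlinarith

/-! ### Histories -/

/-- The moves of player `i` on the path to some node of the information set `I`; under perfect
recall the choice of the node does not matter. -/
noncomputable def hist (I : G.Info i) : List (G.Seq i) := (G.info_occurs i I).choose i

theorem exists_at_decision_eq_hist (I : G.Info i) :
    ∃ h child, G.tree.At h (.decision i I child) ∧ h i = hist I :=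
  ⟨_, (G.info_occurs i I).choose_spec.choose, (G.info_occurs i I).choose_spec.choose_spec, rfl⟩

theorem PerfectRecall.eq_hist (hG : G.PerfectRecall) {I : G.Info i}
    {h : ∀ j, List (G.Seq j)} {child : G.Act i I → GameTree G.Info G.Act}
    (H : G.tree.At h (.decision i I child)) : h i = hist I := by
  obtain ⟨h', child', H', e⟩ := exists_at_decision_eq_hist I
  exact (hG i I h child h' child' H H').trans e

/-- A list of moves of player `i` in which the moves before each move are the history of its
information set: the abstraction of the own moves on a path of the tree on which all arguments
about plans rely. -/
def IsPath (L : List (G.Seq i)) : Prop :=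
  ∀ l σ l', L = l ++ σ :: l' → hist σ.1 = l

/-- The list of moves `L` contains a move at the information set `I`. -/
def Visits (I : G.Info i) (L : List (G.Seq i)) : Prop :=
  ∃ a, (⟨I, a⟩ : G.Seq i) ∈ L

theorem visits_of_mem {L : List (G.Seq i)} {σ : G.Seq i} (hσ : σ ∈ L) : Visits σ.1 L :=
  ⟨σ.2, hσ⟩

theorem visits_cons {I : G.Info i} {σ : G.Seq i} {L : List (G.Seq i)} :
    Visits I (σ :: L) ↔ σ.1 = I ∨ Visits I L := by
  obtain ⟨J, b⟩ := σ
  simp only [Visits, List.mem_cons, exists_or, Sigma.mk.injEq]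
  refine or_congr_left ⟨fun ⟨_, h, _⟩ => h.symm, ?_⟩
  rintro rfl
  exact ⟨b, rfl, HEq.rfl⟩

theorem PerfectRecall.isPath_of_at (hG : G.PerfectRecall) {h : ∀ j, List (G.Seq j)}
    {S : GameTree G.Info G.Act} (H : G.tree.At h S) : IsPath (h i) := by
  intro l σ l' e
  obtain ⟨h', child, H', rfl⟩ := H.exists_at_decision_of_eq_append_cons e
  exact (hG.eq_hist H').symm

theorem PerfectRecall.isPath_own (hG : G.PerfectRecall) (z : G.Z) : IsPath (G.own i z) :=
  let ⟨_, H⟩ := G.tree.at_moves z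
  hG.isPath_of_at H

theorem PerfectRecall.isPath_hist (hG : G.PerfectRecall) (I : G.Info i) : IsPath (hist I) := by
  obtain ⟨h, child, H, e⟩ := exists_at_decision_eq_hist I
  exact e ▸ hG.isPath_of_at H

theorem PerfectRecall.isPath_hist_append_singleton (hG : G.PerfectRecall) (σ : G.Seq i) :
    IsPath (hist σ.1 ++ [σ]) := by
  intro l τ l' e
  rcases List.eq_nil_or_concat l' with rfl | ⟨l'', τ', rfl⟩
  · obtain ⟨rfl, h⟩ := List.append_inj' e rfl
    rw [(List.cons.inj h).1]
  · rw [List.concat_eq_append, ← List.cons_append, ← List.append_assoc] at e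
    exact hG.isPath_hist σ.1 l τ l'' (List.append_inj' e rfl).1

namespace IsPath

variable {L l l' : List (G.Seq i)} {σ τ : G.Seq i}

theorem of_append (h : IsPath (l ++ l')) : IsPath l := fun l₁ σ l₂ e =>
  h l₁ σ (l₂ ++ l') (by simp [e])

theorem exists_eq_hist_append (h : IsPath L) (hσ : σ ∈ L) : ∃ l', L = hist σ.1 ++ σ :: l' := by
  obtain ⟨l, l', e⟩ := List.append_of_mem hσ
  exact ⟨l', by rw [h l σ l' e]; exact e⟩

theorem exists_eq_hist_append_of_visits (h : IsPath L) {I : G.Info i} (hI : Visits I L) :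
    ∃ a l', L = hist I ++ ⟨I, a⟩ :: l' :=
  let ⟨a, ha⟩ := hI
  ⟨a, h.exists_eq_hist_append ha⟩

theorem eq_of_fst_eq (h : IsPath L) (hσ : σ ∈ L) (hτ : τ ∈ L) (e : σ.1 = τ.1) : σ = τ := by
  obtain ⟨l₁, h₁⟩ := h.exists_eq_hist_append hσ
  obtain ⟨l₂, h₂⟩ := h.exists_eq_hist_append hτ
  rw [h₁, e] at h₂
  exact (List.cons.inj (List.append_cancel_left h₂)).1

theorem hist_subset (h : IsPath L) (hσ : σ ∈ L) : hist σ.1 ⊆ L := by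
  obtain ⟨l', e⟩ := h.exists_eq_hist_append hσ
  rw [e]
  exact List.subset_append_left ..

theorem mem_hist_of_mem_right (h : IsPath (l ++ σ :: l')) (hτ : τ ∈ l') : σ ∈ hist τ.1 := by
  obtain ⟨l₁, l₂, rfl⟩ := List.append_of_mem hτ
  rw [h (l ++ σ :: l₁) τ l₂ (by simp)]
  simp

theorem length_hist_lt (h : IsPath L) (hσ : σ ∈ L) : (hist σ.1).length < L.length := by
  obtain ⟨l', e⟩ := h.exists_eq_hist_append hσ
  simp [e]

theorem eq_or_mem_hist_or_mem_hist (h : IsPath L) (hσ : σ ∈ L) (hτ : τ ∈ L) :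
    σ = τ ∨ σ ∈ hist τ.1 ∨ τ ∈ hist σ.1 := by
  obtain ⟨l', rfl⟩ := h.exists_eq_hist_append hσ
  rcases List.mem_append.1 hτ with hτ | hτ
  · exact Or.inr (Or.inr hτ)
  · rcases List.mem_cons.1 hτ with rfl | hτ
    · exact Or.inl rfl
    · exact Or.inr (Or.inl (h.mem_hist_of_mem_right hτ))

theorem injOn_fst (h : IsPath L) : Set.InjOn Sigma.fst {σ | σ ∈ L} :=
  fun _ hσ _ hτ e => h.eq_of_fst_eq hσ hτ e

theorem nodup (h : IsPath L) : L.Nodup := by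
  induction L using List.reverseRecOn with
  | nil => exact List.nodup_nil
  | append_singleton l σ ih =>
    refine List.nodup_append.2 ⟨ih h.of_append, List.nodup_singleton σ, ?_⟩
    rintro τ hτ _ hσ rfl
    obtain rfl := List.mem_singleton.1 hσ
    exact (h.of_append.length_hist_lt hτ).ne (congrArg List.length (h l τ [] rfl))

end IsPath

theorem PerfectRecall.not_visits_hist (hG : G.PerfectRecall) (I : G.Info i) :
    ¬ Visits I (hist I) :=
  fun ⟨_, ha⟩ => ((hG.isPath_hist I).length_hist_lt ha).false

/-! ### Plans -/

section Agrees

variable {π : ∀ I : G.Info i, Option (G.Act i I)} {σ : G.Seq i} {l l' : List (G.Seq i)}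

theorem agrees_nil : Agrees π [] := by
  simp only [Agrees, List.not_mem_nil, false_imp_iff, implies_true]

theorem agrees_cons : Agrees π (σ :: l) ↔ π σ.1 = some σ.2 ∧ Agrees π l := by
  simp only [Agrees, List.mem_cons, forall_eq_or_imp]

theorem agrees_append : Agrees π (l ++ l') ↔ Agrees π l ∧ Agrees π l' := by
  simp only [Agrees, List.mem_append, or_imp, forall_and]

theorem agrees_append_singleton : Agrees π (l ++ [σ]) ↔ Agrees π l ∧ π σ.1 = some σ.2 := by
  simp only [agrees_append, agrees_cons, agrees_nil, and_true]

end Agrees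

theorem PerfectRecall.leadsTo_iff (hG : G.PerfectRecall)
    {π : ∀ I : G.Info i, Option (G.Act i I)} {I : G.Info i} :
    LeadsTo π I ↔ Agrees π (hist I) := by
  constructor
  · rintro ⟨h, child, H, hA⟩
    rwa [hG.eq_hist H] at hA
  · intro hA
    obtain ⟨h, child, H, e⟩ := exists_at_decision_eq_hist I
    exact ⟨h, child, H, e ▸ hA⟩

theorem Plan.toSeq_iff (π : G.Plan i) (σ : G.Seq i) : π.ToSeq σ ↔ π.1 σ.1 = some σ.2 :=
  ⟨And.right, fun h => ⟨(π.2 σ.1).1 (by rw [h]; rfl), h⟩⟩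

theorem PerfectRecall.toSeq_iff_agrees (hG : G.PerfectRecall) (π : G.Plan i) (σ : G.Seq i) :
    π.ToSeq σ ↔ Agrees π.1 (hist σ.1 ++ [σ]) := by
  rw [Plan.ToSeq, hG.leadsTo_iff, agrees_append_singleton]

theorem IsPath.agrees_iff_toSeq (hG : G.PerfectRecall) {l : List (G.Seq i)} {σ : G.Seq i}
    (h : IsPath (l ++ [σ])) (π : G.Plan i) : Agrees π.1 (l ++ [σ]) ↔ π.ToSeq σ := by
  rw [hG.toSeq_iff_agrees, h l σ [] rfl]

open Classical in
/-- The reduced-normal-form plan of a strategy that prescribes an action everywhere. -/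
noncomputable def PerfectRecall.reduce (hG : G.PerfectRecall) (f : ∀ I : G.Info i, G.Act i I) :
    G.Plan i :=
  ⟨fun I => if ∀ σ ∈ hist I, f σ.1 = σ.2 then some (f I) else none, fun I => by
    have hsub {σ} (hσ : σ ∈ hist I) : hist σ.1 ⊆ hist I := (hG.isPath_hist I).hist_subset hσ
    rw [hG.leadsTo_iff]
    simp only [Option.isSome_ite, Agrees, Option.ite_none_right_eq_some, Option.some.injEq]
    exact ⟨fun h σ hσ => ⟨fun τ hτ => h τ (hsub hσ hτ), h σ hσ⟩, fun h σ hσ => (h σ hσ).2⟩⟩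

theorem PerfectRecall.agrees_reduce (hG : G.PerfectRecall) (f : ∀ I : G.Info i, G.Act i I)
    {L : List (G.Seq i)} (hL : IsPath L) :
    Agrees (hG.reduce f).1 L ↔ ∀ σ ∈ L, f σ.1 = σ.2 := by
  simp only [Agrees, PerfectRecall.reduce, Option.ite_none_right_eq_some, Option.some.injEq]
  exact ⟨fun h σ hσ => (h σ hσ).2,
    fun h σ hσ => ⟨fun τ hτ => h τ (hL.hist_subset hσ hτ), h σ hσ⟩⟩

/-- The strategy that follows the plan `π` where `π` prescribes an action, and plays arbitrarily
elsewhere. -/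
noncomputable def Plan.extend (π : G.Plan i) (I : G.Info i) : G.Act i I :=
  (π.1 I).getD (Classical.arbitrary _)

theorem Plan.extend_of_eq_some {π : G.Plan i} {I : G.Info i} {a : G.Act i I}
    (h : π.1 I = some a) : π.extend I = a := by
  rw [Plan.extend, h, Option.getD_some]

theorem PerfectRecall.agrees_iff_extend (hG : G.PerfectRecall) (π : G.Plan i)
    {L : List (G.Seq i)} (hL : IsPath L) :
    Agrees π.1 L ↔ ∀ σ ∈ L, π.extend σ.1 = σ.2 := by
  refine ⟨fun h σ hσ => Plan.extend_of_eq_some (h σ hσ), fun h => ?_⟩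
  induction L using List.reverseRecOn with
  | nil => exact agrees_nil
  | append_singleton l σ ih =>
    have hl : Agrees π.1 l := ih hL.of_append fun τ hτ => h τ (List.mem_append_left _ hτ)
    have hsome : (π.1 σ.1).isSome := by rwa [π.2 σ.1, hG.leadsTo_iff, hL l σ [] rfl]
    obtain ⟨a, ha⟩ := Option.isSome_iff_exists.1 hsome
    exact agrees_append_singleton.2
      ⟨hl, by rw [ha, ← h σ (by simp), Plan.extend_of_eq_some ha]⟩

open Classical in
/-- The strategy that plays `g` from the information set `I` on, and `f` elsewhere. -/
noncomputable def splice (I : G.Info i) (g f : ∀ J : G.Info i, G.Act i J) (J : G.Info i) :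
    G.Act i J :=
  if J = I ∨ Visits I (hist J) then g J else f J

theorem splice_eq_left {I J : G.Info i} (h : J = I ∨ Visits I (hist J))
    (g f : ∀ J : G.Info i, G.Act i J) : splice I g f J = g J := if_pos h

theorem IsPath.forall_splice_iff_of_not_visits {L : List (G.Seq i)} (hL : IsPath L) {I : G.Info i}
    (hI : ¬ Visits I L) (g f : ∀ J : G.Info i, G.Act i J) :
    (∀ σ ∈ L, splice I g f σ.1 = σ.2) ↔ ∀ σ ∈ L, f σ.1 = σ.2 := by
  refine forall₂_congr fun σ hσ => ?_
  rw [splice, if_neg]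
  rintro (rfl | ⟨a, ha⟩)
  exacts [hI (visits_of_mem hσ), hI ⟨a, hL.hist_subset hσ ha⟩]

theorem PerfectRecall.forall_splice_hist_append_iff (hG : G.PerfectRecall) {I : G.Info i}
    {a : G.Act i I} {l' : List (G.Seq i)} (hL : IsPath (hist I ++ ⟨I, a⟩ :: l'))
    (g f : ∀ J : G.Info i, G.Act i J) :
    (∀ σ ∈ hist I ++ ⟨I, a⟩ :: l', splice I g f σ.1 = σ.2) ↔
      (∀ σ ∈ hist I, f σ.1 = σ.2) ∧ ∀ σ ∈ (⟨I, a⟩ : G.Seq i) :: l', g σ.1 = σ.2 := by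
  simp only [List.mem_append, or_imp, forall_and]
  refine and_congr ((hG.isPath_hist I).forall_splice_iff_of_not_visits (hG.not_visits_hist I) g f)
    (forall₂_congr fun σ hσ => ?_)
  rw [splice_eq_left]
  rcases List.mem_cons.1 hσ with rfl | hσ
  exacts [Or.inl rfl, Or.inr ⟨a, hL.mem_hist_of_mem_right hσ⟩]

theorem PerfectRecall.nonempty_planTo (hG : G.PerfectRecall) (I : G.Info i) :
    Nonempty (G.PlanTo I) := by
  classical
  have hpath := hG.isPath_hist I
  let f (J : G.Info i) : G.Act i J :=
    if h : Visits J (hist I) then h.choose else Classical.arbitrary _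
  refine ⟨⟨hG.reduce f, hG.leadsTo_iff.2 ((hG.agrees_reduce f hpath).2 fun σ hσ => ?_)⟩⟩
  have hvisits : Visits σ.1 (hist I) := visits_of_mem hσ
  rw [show f σ.1 = hvisits.choose from dif_pos hvisits]
  exact eq_of_heq (Sigma.mk.inj_iff.1 (hpath.eq_of_fst_eq hvisits.choose_spec hσ rfl)).2

theorem PerfectRecall.exists_planTo_agrees_iff (hG : G.PerfectRecall) (I : G.Info i)
    (b : G.Act i I) (g : ∀ J : G.Info i, G.Act i J) :
    ∃ ρ : G.PlanTo I, ∀ a l', IsPath (hist I ++ ⟨I, a⟩ :: l') →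
      (Agrees ρ.1.1 (hist I ++ ⟨I, a⟩ :: l') ↔ b = a ∧ ∀ τ ∈ l', g τ.1 = τ.2) := by
  classical
  obtain ⟨ρ₀⟩ := hG.nonempty_planTo I
  have hpath := hG.isPath_hist I
  have hf := (hG.agrees_iff_extend ρ₀.1 hpath).1 (hG.leadsTo_iff.1 ρ₀.2)
  let ρ := hG.reduce (splice I (Function.update g I b) ρ₀.1.extend)
  have hρ : LeadsTo ρ.1 I := hG.leadsTo_iff.2 <| (hG.agrees_reduce _ hpath).2 <|
    (hpath.forall_splice_iff_of_not_visits (hG.not_visits_hist I) _ _).2 hf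
  refine ⟨⟨ρ, hρ⟩, fun a l' hL => ?_⟩
  rw [hG.agrees_reduce _ hL, hG.forall_splice_hist_append_iff hL, and_iff_right hf,
    List.forall_mem_cons, Function.update_self]
  refine and_congr_right fun _ => forall₂_congr fun τ hτ => ?_
  rw [Function.update_of_ne]
  rintro rfl
  exact hG.not_visits_hist τ.1 ⟨a, hL.mem_hist_of_mem_right hτ⟩

/-! ### Realization equivalence of the sequence form and mixed plans -/

theorem PerfectRecall.mem_seqForm_iff (hG : G.PerfectRecall) {s : G.Seq i} {y : G.Seq i → ℝ} :
    y ∈ G.SeqForm s ↔ (∀ σ, 0 ≤ y σ) ∧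
      (∀ I, ∑ a, y ⟨I, a⟩ = (hist I).getLast?.elim 1 y) ∧ ∑ a, y ⟨s.1, a⟩ = 1 := by
  refine and_congr_right fun _ => and_congr_left fun _ => ⟨fun h I => ?_, fun h I h' child H => ?_⟩
  · obtain ⟨h', child, H, e⟩ := exists_at_decision_eq_hist I
    rw [← e]
    exact h I h' child H
  · rw [hG.eq_hist H]
    exact h I

theorem seqOf_apply {I : G.Info i} (ν : G.PlanTo I → ℝ) (σ : G.Seq i) :
    seqOf ν σ = ∑ ρ, ν ρ * ind (ρ.1.ToSeq σ) := by
  simp only [seqOf, ite_eq_mul_ind]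

theorem isLinearMap_seqOf (I : G.Info i) : IsLinearMap ℝ (seqOf : (G.PlanTo I → ℝ) → _) where
  map_add ν ν' := funext fun σ => by
    simp only [Pi.add_apply, seqOf_apply, add_mul, Finset.sum_add_distrib]
  map_smul c ν := funext fun σ => by
    simp only [Pi.smul_apply, seqOf_apply, smul_eq_mul, mul_assoc, Finset.mul_sum]

theorem PerfectRecall.getLast?_elim_seqOf (hG : G.PerfectRecall) {I : G.Info i}
    {ν : G.PlanTo I → ℝ} (hν : ∑ ρ, ν ρ = 1) {L : List (G.Seq i)} (hL : IsPath L) :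
    L.getLast?.elim 1 (seqOf ν) = ∑ ρ, ν ρ * ind (Agrees ρ.1.1 L) := by
  rcases List.eq_nil_or_concat L with rfl | ⟨l, σ, rfl⟩
  · simp [ind_of agrees_nil, hν]
  · rw [List.concat_eq_append] at hL ⊢
    simp [hL.agrees_iff_toSeq hG, seqOf_apply]

theorem PerfectRecall.sum_ind_toSeq (hG : G.PerfectRecall) (π : G.Plan i) (I : G.Info i) :
    ∑ a, ind (π.ToSeq ⟨I, a⟩) = ind (Agrees π.1 (hist I)) := by
  simp only [π.toSeq_iff, ← hG.leadsTo_iff, ← π.2 I]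
  rcases π.1 I with _ | b
  · simp [ind]
  · rw [Finset.sum_eq_single b (fun a _ ha => ind_of_not fun e => ha (Option.some.inj e).symm)
      fun h => absurd (Finset.mem_univ b) h, ind_of rfl, ind_of Option.isSome_some]

theorem PerfectRecall.seqOf_mem_seqForm (hG : G.PerfectRecall) (s : G.Seq i)
    {ν : G.PlanTo s.1 → ℝ} (hν : ν ∈ stdSimplex ℝ (G.PlanTo s.1)) : seqOf ν ∈ G.SeqForm s := by
  have hsum (I : G.Info i) : ∑ a, seqOf ν ⟨I, a⟩ = ∑ ρ, ν ρ * ind (Agrees ρ.1.1 (hist I)) := by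
    simp only [seqOf_apply]
    rw [Finset.sum_comm]
    simp only [← Finset.mul_sum, hG.sum_ind_toSeq]
  refine hG.mem_seqForm_iff.2 ⟨fun σ => ?_, fun I => ?_, ?_⟩
  · rw [seqOf_apply]
    exact Finset.sum_nonneg fun ρ _ => mul_nonneg (hν.1 ρ) (ind_nonneg _)
  · rw [hsum, hG.getLast?_elim_seqOf hν.2 (hG.isPath_hist I)]
  · simp only [hsum, ← hG.leadsTo_iff, fun ρ : G.PlanTo s.1 => ind_of ρ.2, mul_one, hν.2]

theorem IsPath.prod_map_eq_getLast?_elim {L : List (G.Seq i)} (hL : IsPath L) {y : G.Seq i → ℝ}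
    (hy : ∀ I, ∑ a, y ⟨I, a⟩ = (hist I).getLast?.elim 1 y) {b : ∀ I, G.Act i I → ℝ}
    (hb : ∀ I a, y ⟨I, a⟩ = (∑ a, y ⟨I, a⟩) * b I a) :
    (L.map fun σ => b σ.1 σ.2).prod = L.getLast?.elim 1 y := by
  induction L using List.reverseRecOn with
  | nil => simp
  | append_singleton l σ ih =>
    calc ((l ++ [σ]).map fun σ => b σ.1 σ.2).prod = l.getLast?.elim 1 y * b σ.1 σ.2 := by
          rw [List.map_append, List.prod_append, ih hL.of_append, List.map_singleton,
            List.prod_singleton]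
      _ = y σ := by rw [hb σ.1 σ.2, hy, hL l σ [] rfl]
      _ = _ := by simp

/-- Kuhn's theorem: the plan is drawn by choosing independently at every information set according
to the conditional probabilities given by `y`. -/
theorem PerfectRecall.exists_mem_stdSimplex_sum_ind_agrees_eq (hG : G.PerfectRecall)
    {y : G.Seq i → ℝ} (hy₀ : ∀ σ, 0 ≤ y σ)
    (hy : ∀ I, ∑ a, y ⟨I, a⟩ = (hist I).getLast?.elim 1 y) :
    ∃ x ∈ stdSimplex ℝ (G.Plan i), ∀ L, IsPath L →
      ∑ π, x π * ind (Agrees π.1 L) = L.getLast?.elim 1 y := by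
  classical
  choose b hb hyb using fun I => exists_mem_stdSimplex_eq_sum_mul fun a => hy₀ ⟨I, a⟩
  obtain ⟨x, hx, hsum⟩ := exists_mem_stdSimplex_sum_mul_eq_sum_mul_comp hG.reduce
    (prod_mem_stdSimplex hb)
  refine ⟨x, hx, fun L hL => ?_⟩
  calc ∑ π, x π * ind (Agrees π.1 L)
      = ∑ f : ∀ I, G.Act i I, if ∀ σ ∈ L.toFinset, f σ.1 = σ.2 then ∏ I, b I (f I) else 0 := by
        simp only [hsum, hG.agrees_reduce _ hL, List.mem_toFinset, ite_eq_mul_ind]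
    _ = ∏ σ ∈ L.toFinset, b σ.1 σ.2 :=
        sum_ite_prod_eq_prod (fun I => (hb I).2) (by simpa using hL.injOn_fst)
    _ = L.getLast?.elim 1 y := by
        rw [List.prod_toFinset _ hL.nodup, hL.prod_map_eq_getLast?_elim hy hyb]

theorem PerfectRecall.exists_seqOf_eq (hG : G.PerfectRecall) (s : G.Seq i) {y : G.Seq i → ℝ}
    (hy : y ∈ G.SeqForm s) : ∃ ν ∈ stdSimplex ℝ (G.PlanTo s.1), seqOf ν = y := by
  obtain ⟨hy₀, hyI, hys⟩ := hG.mem_seqForm_iff.1 hy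
  obtain ⟨x, hx, hxL⟩ := hG.exists_mem_stdSimplex_sum_ind_agrees_eq hy₀ hyI
  have hsupp (π : G.Plan i) (hπ : ¬ LeadsTo π.1 s.1) : x π = 0 :=
    eq_zero_of_sum_mul_ind_eq_one (p := fun π : G.Plan i => LeadsTo π.1 s.1) hx
      (by simp only [hG.leadsTo_iff, hxL _ (hG.isPath_hist s.1), ← hyI, hys]) hπ
  have hsum (f : G.Plan i → ℝ) : ∑ ρ : G.PlanTo s.1, x ρ.1 * f ρ.1 = ∑ π, x π * f π :=
    Fintype.sum_of_injective (fun ρ : G.PlanTo s.1 => ρ.1) Subtype.val_injective _ _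
      (fun π hπ => mul_eq_zero_of_left (hsupp π fun h => hπ ⟨⟨π, h⟩, rfl⟩) _) fun _ => rfl
  refine ⟨fun ρ => x ρ.1, ⟨fun ρ => hx.1 ρ.1, ?_⟩, funext fun σ => ?_⟩
  · simpa [hx.2] using hsum fun _ => 1
  · calc seqOf (fun ρ => x ρ.1) σ = ∑ π, x π * ind (π.ToSeq σ) := by
          rw [seqOf_apply, hsum fun π => ind (π.ToSeq σ)]
      _ = y σ := by
          simp only [hG.toSeq_iff_agrees, hxL _ (hG.isPath_hist_append_singleton σ),
            List.getLast?_append, List.getLast?_singleton, Option.some_or, Option.elim]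

theorem PerfectRecall.seqForm_eq_image (hG : G.PerfectRecall) (s : G.Seq i) :
    G.SeqForm s = seqOf '' stdSimplex ℝ (G.PlanTo s.1) :=
  Set.Subset.antisymm (fun _ hy => hG.exists_seqOf_eq s hy)
    (Set.image_subset_iff.2 fun _ hν => hG.seqOf_mem_seqForm s hν)

theorem PerfectRecall.isPolytope_seqForm (hG : G.PerfectRecall) (s : G.Seq i) :
    IsPolytope (G.SeqForm s) := by
  rw [hG.seqForm_eq_image]
  exact isPolytope_image_stdSimplex (isLinearMap_seqOf s.1)

theorem PerfectRecall.nonempty_seqForm (hG : G.PerfectRecall) (s : G.Seq i) :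
    (G.SeqForm s).Nonempty := by
  have := hG.nonempty_planTo s.1
  rw [hG.seqForm_eq_image]
  exact (Set.nonempty_coe_sort.1 inferInstance).image _

theorem corrPlan_apply (μ : G.Profile → ℝ) (σ : G.Seq i) (z : G.Z) :
    corrPlan μ (⟨i, σ⟩, z) =
      ∑ π, μ π * ind ((π i).ToSeq σ ∧ ∀ j, j ≠ i → (π j).ToTerminal z) := by
  simp only [corrPlan, ite_eq_mul_ind]

theorem isLinearMap_corrPlan : IsLinearMap ℝ (corrPlan : (G.Profile → ℝ) → _) where
  map_add μ μ' := funext fun ⟨⟨i, σ⟩, z⟩ => by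
    simp only [Pi.add_apply, corrPlan_apply, add_mul, Finset.sum_add_distrib]
  map_smul c μ := funext fun ⟨⟨i, σ⟩, z⟩ => by
    simp only [Pi.smul_apply, corrPlan_apply, smul_eq_mul, mul_assoc, Finset.mul_sum]

theorem isPolytope_X (G : Game.{u, v}) : IsPolytope G.X :=
  isPolytope_image_stdSimplex isLinearMap_corrPlan

/-! ### Trigger agents -/

section TriggerPlays

variable {s : G.Seq i} {π ρ : G.Plan i} {L l l' : List (G.Seq i)}

theorem triggerPlays_of_not_visits (h : ¬ Visits s.1 L) : TriggerPlays s π ρ L ↔ Agrees π.1 L := by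
  induction L with
  | nil => simp only [TriggerPlays, agrees_nil]
  | cons σ l ih =>
    rw [visits_cons, not_or] at h
    rw [TriggerPlays, if_neg fun h' => h.1 h'.1, agrees_cons, ih h.2]

theorem triggerPlays_of_ne (h : π.1 s.1 ≠ some s.2) : TriggerPlays s π ρ L ↔ Agrees π.1 L := by
  induction L with
  | nil => simp only [TriggerPlays, agrees_nil]
  | cons σ l ih => rw [TriggerPlays, if_neg fun h' => h h'.2, agrees_cons, ih]

theorem triggerPlays_append (h : π.1 s.1 = some s.2) (hl : ¬ Visits s.1 l) {a : G.Act i s.1} :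
    TriggerPlays s π ρ (l ++ ⟨s.1, a⟩ :: l') ↔ Agrees π.1 l ∧ Agrees ρ.1 (⟨s.1, a⟩ :: l') := by
  induction l with
  | nil => simp only [List.nil_append, TriggerPlays, h, and_self, if_true, agrees_nil, true_and]
  | cons σ l ih =>
    rw [visits_cons, not_or] at hl
    rw [List.cons_append, TriggerPlays, if_neg fun h' => hl.1 h'.1, agrees_cons, ih hl.2,
      and_assoc]

theorem triggerPlays_iff_of_not (h : ¬ (Visits s.1 L ∧ π.ToSeq s)) :
    TriggerPlays s π ρ L ↔ Agrees π.1 L := by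
  rcases not_and_or.1 h with h | h
  · exact triggerPlays_of_not_visits h
  · exact triggerPlays_of_ne (mt (π.toSeq_iff s).2 h)

theorem PerfectRecall.triggerPlays_iff_of_visits (hG : G.PerfectRecall) (hρ : LeadsTo ρ.1 s.1)
    (hL : IsPath L) (h : Visits s.1 L) (hπ : π.ToSeq s) :
    TriggerPlays s π ρ L ↔ Agrees ρ.1 L := by
  obtain ⟨a, l', rfl⟩ := hL.exists_eq_hist_append_of_visits h
  rw [triggerPlays_append hπ.2 (hG.not_visits_hist s.1), agrees_append]
  simp only [hG.leadsTo_iff.1 hπ.1, hG.leadsTo_iff.1 hρ]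

theorem PerfectRecall.exists_plan_triggerPlays (hG : G.PerfectRecall) (s : G.Seq i)
    {ρ : G.Plan i} (hρ : LeadsTo ρ.1 s.1) (π : G.Plan i) :
    ∃ π' : G.Plan i, ∀ L, IsPath L → (Agrees π'.1 L ↔ TriggerPlays s π ρ L) := by
  by_cases hπ : π.ToSeq s
  swap
  · exact ⟨π, fun L _ => (triggerPlays_iff_of_not fun h => hπ h.2).symm⟩
  refine ⟨hG.reduce (splice s.1 ρ.extend π.extend), fun L hL => ?_⟩
  rw [hG.agrees_reduce _ hL]
  by_cases h : Visits s.1 L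
  · rw [hG.triggerPlays_iff_of_visits hρ hL h hπ, hG.agrees_iff_extend ρ hL]
    obtain ⟨a, l', rfl⟩ := hL.exists_eq_hist_append_of_visits h
    have hπ' := (hG.agrees_iff_extend π (hG.isPath_hist s.1)).1 (hG.leadsTo_iff.1 hπ.1)
    have hρ' := (hG.agrees_iff_extend ρ (hG.isPath_hist s.1)).1 (hG.leadsTo_iff.1 hρ)
    rw [hG.forall_splice_hist_append_iff hL, List.forall_mem_append, and_iff_right hπ',
      and_iff_right hρ']
  · rw [triggerPlays_of_not_visits h, hG.agrees_iff_extend π hL,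
      hL.forall_splice_iff_of_not_visits h]

end TriggerPlays

/-! ### Trigger values are gains in utility -/

theorem util_eq (i : Fin 2) (π : G.Profile) (B : List (G.Seq i) → Prop) :
    util i π B = ∑ z, ind (B (G.own i z)) *
      (ind (∀ j, j ≠ i → (π j).ToTerminal z) * (G.tree.chanceProb z * G.tree.payoff z i)) := by
  simp only [util, ite_eq_mul_ind, ind_and]
  exact Finset.sum_congr rfl fun z _ => by ring

theorem util_congr {π : G.Profile} {B B' : List (G.Seq i) → Prop}
    (h : ∀ z, B (G.own i z) ↔ B' (G.own i z)) : util i π B = util i π B' := by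
  simp only [util_eq, h]

theorem PerfectRecall.exists_lastSeq (hG : G.PerfectRecall) {z : G.Z} {σ : G.Seq i}
    (h : σ ∈ G.own i z) :
    ∃ τ, G.lastSeq i z = some τ ∧ ∀ π : G.Plan i, Agrees π.1 (G.own i z) ↔ π.ToSeq τ := by
  have hlast := List.dropLast_append_getLast (List.ne_nil_of_mem h)
  refine ⟨_, List.getLast?_eq_some_getLast (List.ne_nil_of_mem h), fun π => ?_⟩
  rw [← IsPath.agrees_iff_toSeq hG (by rw [hlast]; exact hG.isPath_own z), hlast]

theorem PerfectRecall.ind_triggerPlays (hG : G.PerfectRecall) {s : G.Seq i} {π ρ : G.Plan i}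
    (hρ : LeadsTo ρ.1 s.1) {L : List (G.Seq i)} (hL : IsPath L) :
    ind (TriggerPlays s π ρ L) =
      ind (Visits s.1 L ∧ π.ToSeq s ∧ Agrees ρ.1 L) - ind (s ∈ L ∧ Agrees π.1 L) +
        ind (Agrees π.1 L) := by
  by_cases h : Visits s.1 L ∧ π.ToSeq s
  · have hmem : s ∈ L ∧ Agrees π.1 L ↔ Agrees π.1 L := by
      refine and_iff_right_of_imp fun hA => ?_
      obtain ⟨a, ha⟩ := h.1
      obtain rfl : a = s.2 := Option.some.inj ((hA _ ha).symm.trans h.2.2)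
      exact ha
    simp only [hG.triggerPlays_iff_of_visits hρ hL h.1 h.2, h, hmem, true_and, sub_add_cancel]
  · have hmem : ¬ (s ∈ L ∧ Agrees π.1 L) := fun h' =>
      h ⟨visits_of_mem h'.1, (π.toSeq_iff s).2 (h'.2 s h'.1)⟩
    rw [triggerPlays_iff_of_not h, ← and_assoc, ind_and, ind_of_not h, ind_of_not hmem]
    ring

theorem PerfectRecall.util_triggerPlays (hG : G.PerfectRecall) (s : G.Seq i) (π : G.Profile)
    {ρ : G.Plan i} (hρ : LeadsTo ρ.1 s.1) :
    util i π (TriggerPlays s (π i) ρ) =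
      util i π (fun L => Visits s.1 L ∧ (π i).ToSeq s ∧ Agrees ρ.1 L) -
        util i π (fun L => s ∈ L ∧ Agrees (π i).1 L) + util i π (Agrees (π i).1) := by
  simp only [util_eq, ← Finset.sum_sub_distrib, ← Finset.sum_add_distrib, ← sub_mul, ← add_mul,
    hG.ind_triggerPlays hρ (hG.isPath_own _)]

theorem PerfectRecall.gain_corrPlan_seqOf (hG : G.PerfectRecall) (s : G.Seq i)
    (μ : G.Profile → ℝ) (ν : G.PlanTo s.1 → ℝ) :
    gain s (corrPlan μ) (seqOf ν) = ∑ π, ∑ ρ, μ π * ν ρ *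
      util i π (fun L => Visits s.1 L ∧ (π i).ToSeq s ∧ Agrees ρ.1.1 L) := by
  simp only [util_eq, Finset.mul_sum]
  simp_rw [Finset.sum_comm (s := (Finset.univ : Finset (G.PlanTo s.1)))]
  rw [gain, Finset.sum_comm (s := (Finset.univ : Finset G.Profile))]
  refine Finset.sum_congr rfl fun z _ => ?_
  split_ifs with h
  · obtain ⟨a, ha⟩ := id h
    obtain ⟨τ, hτ, hagrees⟩ := hG.exists_lastSeq ha
    rw [hτ, Option.elim_some, seqOf_apply, corrPlan_apply, mul_assoc, Finset.sum_mul_sum,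
      Finset.mul_sum]
    refine Finset.sum_congr rfl fun π _ => ?_
    rw [Finset.mul_sum]
    refine Finset.sum_congr rfl fun ρ _ => ?_
    rw [ind_and, ind_and, ind_and, hagrees, ind_of (p := Visits s.1 (G.own i z)) h]
    ring
  · simp only [ind_and, ind_of_not (p := Visits s.1 (G.own i z)) h, zero_mul, mul_zero,
      Finset.sum_const_zero]

theorem PerfectRecall.base_corrPlan (hG : G.PerfectRecall) (s : G.Seq i) (μ : G.Profile → ℝ) :
    base s (corrPlan μ) = ∑ π, μ π * util i π (fun L => s ∈ L ∧ Agrees (π i).1 L) := by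
  simp only [util_eq, Finset.mul_sum]
  rw [base, Finset.sum_comm (s := (Finset.univ : Finset G.Profile))]
  refine Finset.sum_congr rfl fun z _ => ?_
  split_ifs with h
  · obtain ⟨τ, hτ, hagrees⟩ := hG.exists_lastSeq h
    rw [hτ, Option.elim_some, corrPlan_apply, Finset.mul_sum]
    refine Finset.sum_congr rfl fun π _ => ?_
    rw [ind_and, ind_and, hagrees, ind_of h]
    ring
  · simp only [ind_and, ind_of_not h, zero_mul, mul_zero, Finset.sum_const_zero]

theorem PerfectRecall.triggerValue_corrPlan_seqOf (hG : G.PerfectRecall) (s : G.Seq i)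
    (μ : G.Profile → ℝ) {ν : G.PlanTo s.1 → ℝ} (hν : ν ∈ stdSimplex ℝ (G.PlanTo s.1)) :
    triggerValue s (corrPlan μ) (seqOf ν) = triggerUtil i s μ ν - followUtil i μ := by
  have hconst (c : G.Profile → ℝ) : ∑ π, μ π * c π = ∑ π, ∑ ρ, μ π * ν ρ * c π := by
    simp only [← Finset.sum_mul, ← Finset.mul_sum, hν.2, mul_one]
  rw [triggerValue, triggerUtil, followUtil, hG.gain_corrPlan_seqOf, hG.base_corrPlan,
    hconst, hconst]
  simp only [← Finset.sum_sub_distrib]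
  refine Finset.sum_congr rfl fun π _ => Finset.sum_congr rfl fun ρ _ => ?_
  rw [hG.util_triggerPlays s π ρ.2]
  ring

theorem triggerUtil_eq_sum (s : G.Seq i) (μ : G.Profile → ℝ) (ν : G.PlanTo s.1 → ℝ) :
    triggerUtil i s μ ν = ∑ ρ, ν ρ * ∑ π, μ π * util i π (TriggerPlays s (π i) ρ.1) := by
  rw [triggerUtil, Finset.sum_comm]
  simp only [Finset.mul_sum]
  exact Finset.sum_congr rfl fun ρ _ => Finset.sum_congr rfl fun π _ => by ring

open Classical in
theorem triggerUtil_single {s : G.Seq i} (μ : G.Profile → ℝ) (ρ : G.PlanTo s.1) :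
    triggerUtil i s μ (Pi.single ρ 1) = ∑ π, μ π * util i π (TriggerPlays s (π i) ρ.1) := by
  simp [triggerUtil_eq_sum, Pi.single_apply]

theorem PerfectRecall.exists_neutral_trigger (hG : G.PerfectRecall) [Nonempty (G.Info i)] :
    ∃ s : G.Seq i, ∃ ν ∈ stdSimplex ℝ (G.PlanTo s.1), ∀ μ : G.Profile → ℝ,
      triggerUtil i s μ ν = followUtil i μ := by
  classical
  obtain ⟨I, hI⟩ := Finite.exists_max fun I : G.Info i => (hist I).length
  obtain ⟨a⟩ : Nonempty (G.Act i I) := inferInstance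
  obtain ⟨ρ, hρ⟩ := hG.exists_planTo_agrees_iff I a fun _ => Classical.arbitrary _
  refine ⟨⟨I, a⟩, Pi.single ρ 1, single_mem_stdSimplex ℝ ρ, fun μ => ?_⟩
  rw [triggerUtil_single, followUtil]
  refine Finset.sum_congr rfl fun π _ => congrArg _ (util_congr fun z => ?_)
  have hpath : IsPath (G.own i z) := hG.isPath_own z
  by_cases h : Visits I (G.own i z) ∧ (π i).ToSeq ⟨I, a⟩
  swap
  · exact triggerPlays_iff_of_not h
  rw [hG.triggerPlays_iff_of_visits ρ.2 hpath h.1 h.2]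
  obtain ⟨⟨hlead, hπ⟩, b, l', hL⟩ := h.2, hpath.exists_eq_hist_append_of_visits h.1
  rw [hL] at hpath ⊢
  obtain rfl : l' = [] := List.eq_nil_iff_forall_not_mem.2 fun σ hσ =>
    (hI σ.1).not_gt <| (hG.isPath_hist σ.1).length_hist_lt (hpath.mem_hist_of_mem_right hσ)
  rw [hρ b [] hpath, agrees_append_singleton, ← hG.leadsTo_iff]
  simp only [List.not_mem_nil, false_imp_iff, implies_true, and_true, hlead, true_and, hπ,
    Option.some.injEq]

/-! ### Trigger agents as deviations -/

theorem PerfectRecall.agrees_hist_of_toSeq (hG : G.PerfectRecall) {π : G.Plan i} {σ : G.Seq i}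
    (h : π.ToSeq σ) : Agrees π.1 (hist σ.1) :=
  hG.leadsTo_iff.1 h.1

theorem Deviation.plays_append_iff {δ : G.Deviation i} {π : G.Plan i} {l l' : List (G.Seq i)}
    (h : ∀ σ ∈ l, ∀ r, π.1 σ.1 = some r → δ.obey ⟨σ.1, r⟩ = r) :
    δ.Plays π (l ++ l') ↔ Agrees π.1 l ∧ δ.Plays π l' := by
  induction l with
  | nil => simp only [List.nil_append, agrees_nil, true_and]
  | cons σ l ih =>
    rw [List.cons_append, Deviation.Plays, agrees_cons, and_assoc,
      ← ih fun τ hτ => h τ (List.mem_cons_of_mem _ hτ)]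
    constructor
    · rintro ⟨r, hr, hobey, hplays⟩
      obtain rfl : r = σ.2 := (h σ List.mem_cons_self r hr).symm.trans hobey
      exact ⟨hr, by rwa [if_pos rfl] at hplays⟩
    · rintro ⟨hσ, hplays⟩
      exact ⟨σ.2, hσ, h σ List.mem_cons_self _ hσ, by rwa [if_pos rfl]⟩

theorem Deviation.plays_iff_agrees {δ : G.Deviation i} {π : G.Plan i} {L : List (G.Seq i)}
    (h : ∀ σ ∈ L, ∀ r, π.1 σ.1 = some r → δ.obey ⟨σ.1, r⟩ = r) :
    δ.Plays π L ↔ Agrees π.1 L := by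
  simpa only [List.append_nil, Deviation.Plays, and_true] using plays_append_iff (l' := []) h

theorem PerfectRecall.plays_iff_of_alone_eq (hG : G.PerfectRecall) {δ : G.Deviation i}
    {π : G.Plan i} {g : ∀ J : G.Info i, G.Act i J} (hg : ∀ σ, δ.alone σ = g)
    {l l' : List (G.Seq i)} (hL : IsPath (l ++ l')) (hl : Agrees π.1 l)
    (hobey : ∀ σ ∈ l', ∀ r, π.1 σ.1 = some r → δ.obey ⟨σ.1, r⟩ = g σ.1) :
    δ.Plays π l' ↔ ∀ σ ∈ l', g σ.1 = σ.2 := by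
  induction l' generalizing l with
  | nil => simp only [Deviation.Plays, List.not_mem_nil, false_imp_iff, implies_true]
  | cons σ l' ih =>
    have hsome : (π.1 σ.1).isSome := by rwa [π.2 σ.1, hG.leadsTo_iff, hL l σ l' rfl]
    obtain ⟨r, hr⟩ := Option.isSome_iff_exists.1 hsome
    rw [Deviation.Plays, List.forall_mem_cons]
    simp only [hr, Option.some.injEq, exists_eq_left', hobey σ List.mem_cons_self r hr, hg]
    refine and_congr_right fun _ => ?_
    split_ifs with hrσ
    · refine ih (l := l ++ [σ]) (by simpa using hL)
        (agrees_append_singleton.2 ⟨hl, hrσ ▸ hr⟩) fun τ hτ => hobey τ (List.mem_cons_of_mem _ hτ)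
    · rfl

open Classical in
/-- The strategy in the extended game of a trigger agent with trigger `s` that deviates to the
plan `ρ`. It keeps playing `ρ` on the recommendations received after `s`, since moving as
recommended at `s` does not count as a deviation for the device. -/
noncomputable def triggerDeviation (s : G.Seq i) (ρ : G.Plan i) : G.Deviation i where
  obey σ := if σ = s ∨ s ∈ hist σ.1 then ρ.extend σ.1 else σ.2
  alone _ := ρ.extend

/-- The strategy `δ` may deviate for the first time on the recommendation `σ`. -/
def Deviation.IsFirst (δ : G.Deviation i) (σ : G.Seq i) : Prop :=
  δ.obey σ ≠ σ.2 ∧ ∀ τ ∈ hist σ.1, δ.obey τ = τ.2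

theorem PerfectRecall.plays_iff_agrees_of_forall_isFirst (hG : G.PerfectRecall)
    {δ : G.Deviation i} {π : G.Plan i} {L : List (G.Seq i)} (hL : IsPath L)
    (h : ∀ σ, δ.IsFirst σ → ¬ (Visits σ.1 L ∧ π.ToSeq σ)) : δ.Plays π L ↔ Agrees π.1 L := by
  refine Deviation.plays_iff_agrees ?_
  induction L using List.reverseRecOn with
  | nil => exact fun σ hσ => absurd hσ List.not_mem_nil
  | append_singleton l σ ih =>
    have ihl := ih hL.of_append fun τ hτ ⟨⟨a, ha⟩, hπ⟩ =>
      h τ hτ ⟨⟨a, List.mem_append_left _ ha⟩, hπ⟩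
    rintro τ hτ r hr
    rcases List.mem_append.1 hτ with hτ | hτ
    · exact ihl τ hτ r hr
    obtain rfl := List.mem_singleton.1 hτ
    have hπ : π.ToSeq ⟨τ.1, r⟩ := (π.toSeq_iff _).2 hr
    by_contra hne
    refine h ⟨τ.1, r⟩ ⟨hne, fun υ hυ => ihl υ ?_ υ.2 (hG.agrees_hist_of_toSeq hπ υ hυ)⟩
      ⟨⟨τ.2, List.mem_append_right _ hτ⟩, hπ⟩
    rwa [← hL l τ [] rfl]

theorem PerfectRecall.triggerDeviation_plays_iff (hG : G.PerfectRecall) {s : G.Seq i}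
    {ρ : G.Plan i} (hρ : LeadsTo ρ.1 s.1) {π : G.Plan i} {L : List (G.Seq i)} (hL : IsPath L) :
    (triggerDeviation s ρ).Plays π L ↔ TriggerPlays s π ρ L := by
  by_cases h : Visits s.1 L ∧ π.ToSeq s
  · obtain ⟨hvisits, hπ⟩ := h
    rw [hG.triggerPlays_iff_of_visits hρ hL hvisits hπ, hG.agrees_iff_extend ρ hL]
    obtain ⟨a, l', rfl⟩ := hL.exists_eq_hist_append_of_visits hvisits
    have hπ' := hG.agrees_hist_of_toSeq hπ
    have hρ' := (hG.agrees_iff_extend ρ (hG.isPath_hist s.1)).1 (hG.leadsTo_iff.1 hρ)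
    rw [Deviation.plays_append_iff, and_iff_right hπ', List.forall_mem_append, and_iff_right hρ']
    · refine hG.plays_iff_of_alone_eq (fun _ => rfl) hL hπ' fun σ hσ r hr => if_pos ?_
      rcases List.mem_cons.1 hσ with rfl | hσ
      · exact Or.inl (Sigma.ext rfl (heq_of_eq (Option.some.inj (hr.symm.trans hπ.2))))
      · have hmem := hL.mem_hist_of_mem_right hσ
        have hagrees := hG.agrees_hist_of_toSeq ((π.toSeq_iff ⟨σ.1, r⟩).2 hr)
        obtain rfl : a = s.2 := Option.some.inj ((hagrees _ hmem).symm.trans hπ.2)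
        exact Or.inr hmem
    · refine fun σ hσ r _ => if_neg ?_
      rintro (rfl | hs)
      exacts [hG.not_visits_hist _ ⟨_, hσ⟩,
        hG.not_visits_hist _ (visits_of_mem ((hG.isPath_hist s.1).hist_subset hσ hs))]
  · rw [triggerPlays_iff_of_not h]
    refine hG.plays_iff_agrees_of_forall_isFirst hL fun σ hσ ⟨⟨a, ha⟩, hπ⟩ => ?_
    rcases Classical.not_not.1 (mt (if_neg ·) hσ.1) with rfl | hs
    · exact h ⟨⟨a, ha⟩, hπ⟩
    · exact h ⟨visits_of_mem (hL.hist_subset ha hs),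
        (π.toSeq_iff s).2 (hG.agrees_hist_of_toSeq hπ s hs)⟩

theorem PerfectRecall.triggerUtil_le_of_isEFCE (hG : G.PerfectRecall) {μ : G.Profile → ℝ}
    (hμ : IsEFCE μ) (s : G.Seq i) {ν : G.PlanTo s.1 → ℝ}
    (hν : ν ∈ stdSimplex ℝ (G.PlanTo s.1)) : triggerUtil i s μ ν ≤ followUtil i μ := by
  rw [triggerUtil_eq_sum]
  refine sum_mul_le_of_mem_stdSimplex hν fun ρ => ?_
  simpa only [util_congr fun z => hG.triggerDeviation_plays_iff ρ.2 (hG.isPath_own z)]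
    using hμ i (triggerDeviation s ρ.1)

/-! ### Deviations decompose into trigger agents -/

theorem PerfectRecall.plays_iff_of_isFirst (hG : G.PerfectRecall) {δ : G.Deviation i}
    {π : G.Plan i} {σ : G.Seq i} (hσ : δ.IsFirst σ) (hπ : π.ToSeq σ) {a : G.Act i σ.1}
    {l' : List (G.Seq i)} :
    δ.Plays π (hist σ.1 ++ ⟨σ.1, a⟩ :: l') ↔
      δ.obey σ = a ∧ ∀ τ ∈ l', δ.alone σ τ.1 = τ.2 := by
  have hagrees := hG.agrees_hist_of_toSeq hπ
  rw [Deviation.plays_append_iff, and_iff_right hagrees, Deviation.Plays]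
  · simp only [hπ.2, Option.some.injEq, exists_eq_left']
    refine and_congr_right fun ha => ?_
    rw [if_neg fun h => hσ.1 (ha.trans h.symm)]
  · intro τ hτ r hr
    obtain rfl : r = τ.2 := Option.some.inj (hr.symm.trans (hagrees τ hτ))
    exact hσ.2 τ hτ

theorem PerfectRecall.isFirst_unique (hG : G.PerfectRecall) {δ : G.Deviation i} {π : G.Plan i}
    {L : List (G.Seq i)} (hL : IsPath L) {σ τ : G.Seq i} (hσ : δ.IsFirst σ) (hτ : δ.IsFirst τ)
    (hσL : Visits σ.1 L ∧ π.ToSeq σ) (hτL : Visits τ.1 L ∧ π.ToSeq τ) : σ = τ := by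
  have hnot {σ τ : G.Seq i} (hσ : δ.IsFirst σ) (hτ : δ.IsFirst τ) (hπσ : π.ToSeq σ)
      (hπτ : π.ToSeq τ) (a : G.Act i σ.1) : (⟨σ.1, a⟩ : G.Seq i) ∉ hist τ.1 := fun ha => by
    obtain rfl : a = σ.2 :=
      Option.some.inj ((hG.agrees_hist_of_toSeq hπτ _ ha).symm.trans hπσ.2)
    exact hσ.1 (hτ.2 σ ha)
  obtain ⟨⟨⟨a, ha⟩, hπσ⟩, ⟨b, hb⟩, hπτ⟩ := hσL, hτL
  rcases hL.eq_or_mem_hist_or_mem_hist ha hb with h | h | h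
  · obtain ⟨⟨I, a'⟩, ⟨J, b'⟩⟩ := σ, τ
    obtain rfl : I = J := congrArg Sigma.fst h
    exact Sigma.ext rfl (heq_of_eq (Option.some.inj (hπσ.2.symm.trans hπτ.2)))
  · exact absurd h (hnot hσ hτ hπσ hπτ a)
  · exact absurd h (hnot hτ hσ hπτ hπσ b)

/-- A deviation is, up to its first deviating move, the same as following the recommendations, and
from there on the same as a trigger agent; at most one trigger is active on each path. -/
theorem PerfectRecall.exists_ind_plays_eq (hG : G.PerfectRecall) (δ : G.Deviation i) :
    ∃ ρ : ∀ σ : G.Seq i, G.PlanTo σ.1, ∀ (π : G.Plan i) (L : List (G.Seq i)), IsPath L →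
      ind (δ.Plays π L) = ind (Agrees π.1 L) +
        ∑ σ, ind (δ.IsFirst σ) * (ind (TriggerPlays σ π (ρ σ).1 L) - ind (Agrees π.1 L)) := by
  choose ρ hρ using fun σ : G.Seq i =>
    hG.exists_planTo_agrees_iff σ.1 (δ.obey σ) (δ.alone σ)
  refine ⟨ρ, fun π L hL => ?_⟩
  have hzero (τ : G.Seq i) (h : δ.IsFirst τ → ¬ (Visits τ.1 L ∧ π.ToSeq τ)) :
      ind (δ.IsFirst τ) * (ind (TriggerPlays τ π (ρ τ).1 L) - ind (Agrees π.1 L)) = 0 := by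
    by_cases hτ : δ.IsFirst τ
    · rw [triggerPlays_iff_of_not (h hτ), sub_self, mul_zero]
    · rw [ind_of_not hτ, zero_mul]
  by_cases h : ∃ σ, δ.IsFirst σ ∧ Visits σ.1 L ∧ π.ToSeq σ
  · obtain ⟨σ, hσ, hσL⟩ := h
    have hplays : δ.Plays π L ↔ TriggerPlays σ π (ρ σ).1 L := by
      rw [hG.triggerPlays_iff_of_visits (ρ σ).2 hL hσL.1 hσL.2]
      obtain ⟨a, l', rfl⟩ := hL.exists_eq_hist_append_of_visits hσL.1
      rw [hG.plays_iff_of_isFirst hσ hσL.2, hρ σ a l' hL]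
    rw [Finset.sum_eq_single σ
      (fun τ _ hne => hzero τ fun hτ hτL => hne (hG.isFirst_unique hL hτ hσ hτL hσL))
      fun h => absurd (Finset.mem_univ σ) h, ind_of hσ, hplays]
    ring
  · rw [hG.plays_iff_agrees_of_forall_isFirst hL fun σ hσ hσL => h ⟨σ, hσ, hσL⟩,
      Finset.sum_eq_zero fun σ _ => hzero σ fun hσ hσL => h ⟨σ, hσ, hσL⟩, add_zero]

theorem PerfectRecall.exists_sum_util_plays_eq (hG : G.PerfectRecall) (μ : G.Profile → ℝ)
    (δ : G.Deviation i) : ∃ ρ : ∀ σ : G.Seq i, G.PlanTo σ.1,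
      ∑ π, μ π * util i π (δ.Plays (π i)) = followUtil i μ + ∑ σ, ind (δ.IsFirst σ) *
        (∑ π, μ π * util i π (TriggerPlays σ (π i) (ρ σ).1) - followUtil i μ) := by
  obtain ⟨ρ, hρ⟩ := hG.exists_ind_plays_eq δ
  refine ⟨ρ, ?_⟩
  have hutil (π : G.Profile) : util i π (δ.Plays (π i)) = util i π (Agrees (π i).1) +
      ∑ σ, ind (δ.IsFirst σ) *
        (util i π (TriggerPlays σ (π i) (ρ σ).1) - util i π (Agrees (π i).1)) := by
    simp only [util_eq, hρ _ _ (hG.isPath_own _), add_mul, Finset.sum_add_distrib, Finset.sum_mul,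
      ← Finset.sum_sub_distrib, ← sub_mul, Finset.mul_sum, mul_assoc]
    rw [Finset.sum_comm]
  simp only [followUtil, hutil, mul_add, Finset.sum_add_distrib, ← Finset.sum_sub_distrib,
    ← mul_sub, Finset.mul_sum]
  rw [Finset.sum_comm]
  simp only [mul_left_comm]

theorem PerfectRecall.isEFCE_iff_triggerUtil_le (hG : G.PerfectRecall) (μ : G.Profile → ℝ) :
    IsEFCE μ ↔ ∀ (i : Fin 2) (s : G.Seq i), ∀ ν ∈ stdSimplex ℝ (G.PlanTo s.1),
      triggerUtil i s μ ν ≤ followUtil i μ := by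
  classical
  refine ⟨fun hμ i s ν hν => hG.triggerUtil_le_of_isEFCE hμ s hν, fun h i δ => ?_⟩
  obtain ⟨ρ, hρ⟩ := hG.exists_sum_util_plays_eq μ δ
  have hle (σ : G.Seq i) :
      ∑ π, μ π * util i π (TriggerPlays σ (π i) (ρ σ).1) ≤ followUtil i μ := by
    rw [← triggerUtil_single]
    exact h i σ _ (single_mem_stdSimplex ℝ (ρ σ))
  rw [hρ]
  exact add_le_of_nonpos_right <| Finset.sum_nonpos fun σ _ =>
    mul_nonpos_of_nonneg_of_nonpos (ind_nonneg _) (sub_nonpos.2 (hle σ))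

/-! ### Existence -/

theorem util_update (π : G.Profile) (π' : G.Plan i) (B : List (G.Seq i) → Prop) :
    util i (Function.update π i π') B = util i π B := by
  have hother (z : G.Z) : (∀ j, j ≠ i → (Function.update π i π' j).ToTerminal z) ↔
      ∀ j, j ≠ i → (π j).ToTerminal z :=
    forall₂_congr fun j hj => by rw [Function.update_of_ne hj]
  simp only [util_eq, hother]

theorem PerfectRecall.exists_isEFCE (hG : G.PerfectRecall) : ∃ μ ∈ G.CorrDist, IsEFCE μ := by
  have (i : Fin 2) : Nonempty (G.Plan i) := ⟨hG.reduce fun _ => Classical.arbitrary _⟩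
  obtain ⟨μ, hμ, hle⟩ := exists_correlatedEquilibrium fun i (π : G.Profile) =>
    util i π (Agrees (π i).1)
  refine ⟨μ, hμ, (hG.isEFCE_iff_triggerUtil_le μ).2 fun i s ν hν => ?_⟩
  rw [triggerUtil_eq_sum]
  refine sum_mul_le_of_mem_stdSimplex hν fun ρ => ?_
  choose φ hφ using hG.exists_plan_triggerPlays s ρ.2
  simpa only [followUtil, Function.update_self, util_update,
    util_congr fun z => hφ _ _ (hG.isPath_own z)] using hle i φ

/-! ### Bilinearity -/

/-- The matrix of the bilinear form `gain s`. -/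
noncomputable def gainMatrix (s : G.Seq i) : Matrix (G.Seq i × G.Z) (G.Seq i) ℝ := fun x τ =>
  ind (x.1 = s) * ind (Visits s.1 (G.own i x.2)) * ind (G.lastSeq i x.2 = some τ) *
    (G.tree.chanceProb x.2 * G.tree.payoff x.2 i)

/-- The coefficients of the linear form `base s`. -/
noncomputable def baseVector (s : G.Seq i) : G.Seq i × G.Z → ℝ := fun x =>
  ind (s ∈ G.own i x.2) * ind (G.lastSeq i x.2 = some x.1) *
    (G.tree.chanceProb x.2 * G.tree.payoff x.2 i)

theorem gain_eq_dotProduct_mulVec (s : G.Seq i) (ξ : G.XIdx → ℝ) (y : G.Seq i → ℝ) :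
    gain s ξ y = (fun x => ξ (⟨i, x.1⟩, x.2)) ⬝ᵥ (gainMatrix s *ᵥ y) := by
  simp only [dotProduct, Matrix.mulVec, gainMatrix, Fintype.sum_prod_type_right]
  refine Finset.sum_congr rfl fun z _ => ?_
  rw [Finset.sum_eq_single s (fun σ _ hσ => by simp [ind_of_not hσ]) (by simp), ite_eq_mul_ind,
    option_elim_eq_sum_ind, Finset.mul_sum, Finset.sum_mul, Finset.mul_sum, ind_of rfl]
  exact Finset.sum_congr rfl fun τ _ => by rw [Visits]; ring

theorem base_eq_dotProduct (s : G.Seq i) (ξ : G.XIdx → ℝ) :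
    base s ξ = baseVector s ⬝ᵥ fun x => ξ (⟨i, x.1⟩, x.2) := by
  simp only [dotProduct, baseVector, Fintype.sum_prod_type_right]
  refine Finset.sum_congr rfl fun z _ => ?_
  rw [ite_eq_mul_ind, option_elim_eq_sum_ind, Finset.mul_sum, Finset.sum_mul]
  exact Finset.sum_congr rfl fun τ _ => by ring

theorem exists_matrix_gain_base (s : G.Seq i) :
    ∃ (A : Matrix (G.Seq i × G.Z) (G.Seq i) ℝ) (b : G.Seq i × G.Z → ℝ),
      ∀ (ξ : G.XIdx → ℝ) (y : G.Seq i → ℝ),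
        gain s ξ y = (fun x => ξ (⟨i, x.1⟩, x.2)) ⬝ᵥ (A *ᵥ y) ∧
        base s ξ = b ⬝ᵥ (fun x => ξ (⟨i, x.1⟩, x.2)) :=
  ⟨gainMatrix s, baseVector s, fun ξ y =>
    ⟨gain_eq_dotProduct_mulVec s ξ y, base_eq_dotProduct s ξ⟩⟩

theorem isLinearMap_gain_left (s : G.Seq i) (y : G.Seq i → ℝ) :
    IsLinearMap ℝ fun ξ : G.XIdx → ℝ => gain s ξ y where
  map_add ξ ξ' := by
    simp only [gain_eq_dotProduct_mulVec]
    exact add_dotProduct _ _ _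
  map_smul c ξ := by
    simp only [gain_eq_dotProduct_mulVec]
    exact smul_dotProduct _ _ _

theorem isLinearMap_gain_right (s : G.Seq i) (ξ : G.XIdx → ℝ) : IsLinearMap ℝ (gain s ξ) where
  map_add y y' := by
    simp only [gain_eq_dotProduct_mulVec, Matrix.mulVec_add, dotProduct_add]
  map_smul c y := by
    simp only [gain_eq_dotProduct_mulVec, Matrix.mulVec_smul, dotProduct_smul]

theorem isLinearMap_base (s : G.Seq i) : IsLinearMap ℝ (base s : (G.XIdx → ℝ) → ℝ) where
  map_add ξ ξ' := by
    simp only [base_eq_dotProduct]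
    exact dotProduct_add _ _ _
  map_smul c ξ := by
    simp only [base_eq_dotProduct]
    exact dotProduct_smul _ _ _

theorem isLinearMap_objective_left (w : G.YIdx → ℝ) :
    IsLinearMap ℝ fun ξ : G.XIdx → ℝ => objective ξ w where
  map_add ξ ξ' := by
    simp only [objective, (isLinearMap_gain_left _ _).map_add, (isLinearMap_base _).map_add,
      ← Finset.sum_add_distrib]
    exact Finset.sum_congr rfl fun i _ => Finset.sum_congr rfl fun s _ => by ring
  map_smul c ξ := by
    simp only [objective, (isLinearMap_gain_left _ _).map_smul, (isLinearMap_base _).map_smul,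
      smul_eq_mul, Finset.mul_sum]
    exact Finset.sum_congr rfl fun i _ => Finset.sum_congr rfl fun s _ => by ring

theorem isLinearMap_objective_right (ξ : G.XIdx → ℝ) : IsLinearMap ℝ (objective ξ) where
  map_add w w' := by
    have hzvec i s : zvec (w + w') i s = zvec w i s + zvec w' i s := rfl
    have hlam i s : lam (w + w') i s = lam w i s + lam w' i s := rfl
    simp only [objective, hzvec, hlam, (isLinearMap_gain_right _ ξ).map_add,
      ← Finset.sum_add_distrib]
    exact Finset.sum_congr rfl fun i _ => Finset.sum_congr rfl fun s _ => by ring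
  map_smul c w := by
    have hzvec i s : zvec (c • w) i s = c • zvec w i s := rfl
    have hlam i s : lam (c • w) i s = c * lam w i s := rfl
    simp only [objective, hzvec, hlam, (isLinearMap_gain_right _ ξ).map_smul, smul_eq_mul,
      Finset.mul_sum]
    exact Finset.sum_congr rfl fun i _ => Finset.sum_congr rfl fun s _ => by ring

theorem exists_matrix_objective (G : Game.{u, v}) :
    ∃ M : Matrix G.XIdx G.YIdx ℝ, ∀ ξ w, objective ξ w = ξ ⬝ᵥ (M *ᵥ w) :=
  exists_matrix_eq_dotProduct_mulVec isLinearMap_objective_left isLinearMap_objective_right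

theorem continuous_triggerValue (s : G.Seq i) (ξ : G.XIdx → ℝ) :
    Continuous (triggerValue s ξ) :=
  (isLinearMap_gain_right s ξ).mk' _ |>.continuous_of_finiteDimensional |>.sub continuous_const

/-! ### The saddle-point problem -/

/-- The point of `𝒴` with multipliers `l` and, for each trigger, the deviation `y`. -/
def mixture (l : G.Trigger → ℝ) (y : ∀ t : G.Trigger, G.Seq t.1 → ℝ) : G.YIdx → ℝ
  | Sum.inl t => l t
  | Sum.inr ⟨j, s, τ⟩ => l ⟨j, s⟩ * y ⟨j, s⟩ τ

/-- The point of `𝒴` given by a joint distribution of a trigger and a plan to deviate to. -/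
noncomputable def planMixture (x : (Σ t : G.Trigger, G.PlanTo t.2.1) → ℝ) : G.YIdx → ℝ
  | Sum.inl t => ∑ ρ, x ⟨t, ρ⟩
  | Sum.inr ⟨j, s, τ⟩ => seqOf (fun ρ : G.PlanTo s.1 => x ⟨⟨j, s⟩, ρ⟩) τ

theorem mem_Y_iff {w : G.YIdx → ℝ} :
    w ∈ G.Y ↔ ∃ l ∈ stdSimplex ℝ G.Trigger, ∃ y : ∀ t : G.Trigger, G.Seq t.1 → ℝ,
      (∀ t, y t ∈ G.SeqForm t.2) ∧ w = mixture l y := by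
  constructor
  · rintro ⟨hlam, hsum, hzvec⟩
    choose y hy hyz using fun t : G.Trigger => Set.mem_smul_set.1 (hzvec t.1 t.2)
    refine ⟨fun t => lam w t.1 t.2, ⟨fun t => (hlam t.1 t.2).1, ?_⟩, y, hy, funext ?_⟩
    · rwa [Fintype.sum_sigma]
    · rintro (t | ⟨j, s, τ⟩)
      exacts [rfl, (congrFun (hyz ⟨j, s⟩) τ).symm]
  · rintro ⟨l, hl, y, hy, rfl⟩
    exact ⟨fun j s => ⟨hl.1 ⟨j, s⟩, hl.2 ▸ Finset.single_le_sum (fun t _ => hl.1 t)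
      (Finset.mem_univ (⟨j, s⟩ : G.Trigger))⟩, (Fintype.sum_sigma l).symm.trans hl.2,
      fun j s => Set.mem_smul_set.2 ⟨_, hy ⟨j, s⟩, rfl⟩⟩

theorem objective_mixture (ξ : G.XIdx → ℝ) (l : G.Trigger → ℝ)
    (y : ∀ t : G.Trigger, G.Seq t.1 → ℝ) :
    objective ξ (mixture l y) = ∑ t, l t * triggerValue t.2 ξ (y t) := by
  rw [Fintype.sum_sigma]
  refine Finset.sum_congr rfl fun j _ => Finset.sum_congr rfl fun s _ => ?_
  have hzvec : zvec (mixture l y) j s = l ⟨j, s⟩ • y ⟨j, s⟩ := rfl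
  rw [hzvec, (isLinearMap_gain_right s ξ).map_smul, smul_eq_mul, triggerValue, mul_sub]
  rfl

theorem isLinearMap_planMixture (G : Game.{u, v}) : IsLinearMap ℝ (planMixture (G := G)) where
  map_add x x' := by
    ext (t | ⟨j, s, τ⟩)
    · exact Finset.sum_add_distrib
    · exact congrFun ((isLinearMap_seqOf s.1).map_add _ _) τ
  map_smul c x := by
    ext (t | ⟨j, s, τ⟩)
    · exact (Finset.mul_sum _ _ _).symm
    · exact congrFun ((isLinearMap_seqOf s.1).map_smul c _) τ

theorem planMixture_mul (l : G.Trigger → ℝ) {ν : ∀ t : G.Trigger, G.PlanTo t.2.1 → ℝ}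
    (hν : ∀ t, ∑ ρ, ν t ρ = 1) :
    planMixture (fun p => l p.1 * ν p.1 p.2) = mixture l fun t => seqOf (ν t) := by
  ext (t | ⟨j, s, τ⟩)
  · simp only [planMixture, mixture, ← Finset.mul_sum, hν, mul_one]
  · exact congrFun ((isLinearMap_seqOf s.1).map_smul (l ⟨j, s⟩) (ν ⟨j, s⟩)) τ

theorem PerfectRecall.Y_eq_image (hG : G.PerfectRecall) :
    G.Y = planMixture '' stdSimplex ℝ (Σ t : G.Trigger, G.PlanTo t.2.1) := by
  have (t : G.Trigger) : Nonempty (G.PlanTo t.2.1) := hG.nonempty_planTo t.2.1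
  ext w
  simp only [mem_Y_iff, Set.mem_image, mem_stdSimplex_sigma_iff]
  constructor
  · rintro ⟨l, hl, y, hy, rfl⟩
    choose ν hν hνy using fun t : G.Trigger => hG.exists_seqOf_eq t.2 (hy t)
    refine ⟨_, ⟨l, hl, ν, hν, rfl⟩, ?_⟩
    simp only [planMixture_mul l fun t => (hν t).2, hνy]
  · rintro ⟨_, ⟨l, hl, ν, hν, rfl⟩, rfl⟩
    exact ⟨l, hl, _, fun t => hG.seqOf_mem_seqForm t.2 (hν t),
      planMixture_mul l fun t => (hν t).2⟩

theorem PerfectRecall.isPolytope_Y (hG : G.PerfectRecall) : IsPolytope G.Y := by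
  rw [hG.Y_eq_image]
  exact isPolytope_image_stdSimplex (isLinearMap_planMixture G)

theorem PerfectRecall.exists_objective_eq (hG : G.PerfectRecall) (s : G.Seq i)
    {y : G.Seq i → ℝ} (hy : y ∈ G.SeqForm s) :
    ∃ w ∈ G.Y, ∀ ξ, objective ξ w = triggerValue s ξ y := by
  classical
  choose y₀ hy₀ using fun t : G.Trigger => hG.nonempty_seqForm t.2
  refine ⟨mixture (Pi.single ⟨i, s⟩ 1) (Function.update y₀ ⟨i, s⟩ y),
    mem_Y_iff.2 ⟨_, single_mem_stdSimplex ℝ _, _, fun t => ?_, rfl⟩, fun ξ => ?_⟩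
  · rcases eq_or_ne t ⟨i, s⟩ with rfl | h
    · rwa [Function.update_self]
    · rw [Function.update_of_ne h]
      exact hy₀ t
  · rw [objective_mixture, Finset.sum_eq_single ⟨i, s⟩ (fun t _ ht => by simp [ht]) (by simp)]
    simp

theorem PerfectRecall.isGreatest_vStar (hG : G.PerfectRecall) (hne : ∃ i, Nonempty (G.Info i))
    (ξ : G.XIdx → ℝ) : IsGreatest (deviationValues ξ) (vStar ξ) := by
  have hunion : deviationValues ξ = ⋃ t : G.Trigger, triggerValue t.2 ξ '' G.SeqForm t.2 := by
    ext r
    simp only [deviationValues, Set.mem_ofPred_eq, Set.mem_iUnion, Set.mem_image, Sigma.exists,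
      eq_comm]
  have hcompact : IsCompact (deviationValues ξ) := by
    rw [hunion]
    exact isCompact_iUnion fun t =>
      (hG.isPolytope_seqForm t.2).isCompact.image (continuous_triggerValue t.2 ξ)
  refine hcompact.isGreatest_sSup ?_
  obtain ⟨i, ⟨I⟩⟩ := hne
  obtain ⟨y, hy⟩ := hG.nonempty_seqForm (⟨I, Classical.arbitrary _⟩ : G.Seq i)
  exact ⟨_, i, _, y, hy, rfl⟩

theorem PerfectRecall.isGreatest_objective (hG : G.PerfectRecall)
    (hne : ∃ i, Nonempty (G.Info i)) (ξ : G.XIdx → ℝ) :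
    IsGreatest (objective ξ '' G.Y) (vStar ξ) := by
  obtain ⟨⟨i, s, y, hy, hvalue⟩, hle⟩ := hG.isGreatest_vStar hne ξ
  constructor
  · obtain ⟨w, hw, hobj⟩ := hG.exists_objective_eq s hy
    exact ⟨w, hw, (hobj ξ).trans hvalue.symm⟩
  · rintro _ ⟨w, hw, rfl⟩
    obtain ⟨l, hl, y, hy, rfl⟩ := mem_Y_iff.1 hw
    rw [objective_mixture]
    exact sum_mul_le_of_mem_stdSimplex hl fun t => hle ⟨t.1, t.2, y t, hy t, rfl⟩

theorem PerfectRecall.isEFCE_iff_vStar_nonpos (hG : G.PerfectRecall)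
    (hne : ∃ i, Nonempty (G.Info i)) (μ : G.Profile → ℝ) :
    IsEFCE μ ↔ vStar (corrPlan μ) ≤ 0 := by
  rw [hG.isEFCE_iff_triggerUtil_le, isLUB_le_iff (hG.isGreatest_vStar hne (corrPlan μ)).isLUB]
  constructor
  · rintro h _ ⟨i, s, y, hy, rfl⟩
    obtain ⟨ν, hν, rfl⟩ := hG.exists_seqOf_eq s hy
    rw [hG.triggerValue_corrPlan_seqOf s μ hν]
    exact sub_nonpos.2 (h i s ν hν)
  · intro h i s ν hν
    rw [← sub_nonpos, ← hG.triggerValue_corrPlan_seqOf s μ hν]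
    exact h ⟨i, s, _, hG.seqOf_mem_seqForm s hν, rfl⟩

theorem PerfectRecall.isEFCEPlan_iff_vStar_nonpos (hG : G.PerfectRecall)
    (hne : ∃ i, Nonempty (G.Info i)) {ξ : G.XIdx → ℝ} (hξ : ξ ∈ G.X) :
    IsEFCEPlan ξ ↔ vStar ξ ≤ 0 := by
  constructor
  · rintro ⟨μ, -, rfl, h⟩
    exact (hG.isEFCE_iff_vStar_nonpos hne μ).1 h
  · obtain ⟨μ, hμ, rfl⟩ := hξ
    exact fun h => ⟨μ, hμ, rfl, (hG.isEFCE_iff_vStar_nonpos hne μ).2 h⟩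

theorem PerfectRecall.exists_objective_eq_zero (hG : G.PerfectRecall)
    (hne : ∃ i, Nonempty (G.Info i)) : ∃ w ∈ G.Y, ∀ ξ ∈ G.X, objective ξ w = 0 := by
  obtain ⟨i, hi⟩ := hne
  obtain ⟨s, ν, hν, hneutral⟩ := hG.exists_neutral_trigger (i := i)
  obtain ⟨w, hw, hobj⟩ := hG.exists_objective_eq s (hG.seqOf_mem_seqForm s hν)
  refine ⟨w, hw, ?_⟩
  rintro _ ⟨μ, -, rfl⟩
  rw [hobj, hG.triggerValue_corrPlan_seqOf s μ hν, hneutral, sub_self]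

theorem PerfectRecall.isLeast_vStar (hG : G.PerfectRecall) (hne : ∃ i, Nonempty (G.Info i)) :
    IsLeast (vStar '' G.X) 0 := by
  obtain ⟨w, hw, hzero⟩ := hG.exists_objective_eq_zero hne
  have hnonneg {ξ : G.XIdx → ℝ} (hξ : ξ ∈ G.X) : 0 ≤ vStar ξ :=
    (hG.isGreatest_objective hne ξ).2 ⟨w, hw, hzero ξ hξ⟩
  refine ⟨?_, Set.forall_mem_image.2 fun ξ hξ => hnonneg hξ⟩
  obtain ⟨μ, hμ, h⟩ := hG.exists_isEFCE
  have hξ : corrPlan μ ∈ G.X := Set.mem_image_of_mem _ hμ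
  exact ⟨_, hξ, le_antisymm ((hG.isEFCE_iff_vStar_nonpos hne μ).1 h) (hnonneg hξ)⟩

theorem PerfectRecall.isEFCEPlan_iff_isMinOn (hG : G.PerfectRecall)
    (hne : ∃ i, Nonempty (G.Info i)) {ξ : G.XIdx → ℝ} (hξ : ξ ∈ G.X) :
    IsEFCEPlan ξ ↔ IsMinOn vStar G.X ξ := by
  rw [hG.isEFCEPlan_iff_vStar_nonpos hne hξ, isMinOn_iff]
  obtain ⟨⟨ξ₀, hξ₀, hzero⟩, hle⟩ := hG.isLeast_vStar hne
  exact ⟨fun h ξ' hξ' => h.trans (hle ⟨ξ', hξ', rfl⟩), fun h => (h ξ₀ hξ₀).trans hzero.le⟩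

theorem PerfectRecall.isEFCEPlan_iff_exists_isSaddlePointOn (hG : G.PerfectRecall)
    (hne : ∃ i, Nonempty (G.Info i)) {ξ : G.XIdx → ℝ} (hξ : ξ ∈ G.X) :
    IsEFCEPlan ξ ↔ ∃ w ∈ G.Y, IsSaddlePointOn G.X G.Y objective ξ w := by
  constructor
  · intro h
    obtain ⟨w, hw, hzero⟩ := hG.exists_objective_eq_zero hne
    refine ⟨w, hw, fun ξ' hξ' w' hw' => ?_⟩
    rw [hzero ξ' hξ']
    exact ((hG.isGreatest_objective hne ξ).2 ⟨w', hw', rfl⟩).trans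
      ((hG.isEFCEPlan_iff_vStar_nonpos hne hξ).1 h)
  · rintro ⟨w, hw, hsaddle⟩
    refine (hG.isEFCEPlan_iff_isMinOn hne hξ).2 (isMinOn_iff.2 fun ξ' hξ' => ?_)
    obtain ⟨w', hw', hvalue⟩ := (hG.isGreatest_objective hne ξ).1
    rw [← hvalue]
    exact (hsaddle ξ' hξ' w' hw').trans ((hG.isGreatest_objective hne ξ').2 ⟨w, hw, rfl⟩)

end Game

theorem mainTheorem1 (G : Game.{u, v}) (hG : G.PerfectRecall) (hne : ∃ i, Nonempty (G.Info i)) :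
    -- `𝒳`, `𝒴` and the sets of sequence-form deviations are polytopes, and the dimensions of the
    -- ambient spaces of `𝒳` and `𝒴` are at most quadratic in the size of the game
    IsPolytope G.X ∧ IsPolytope G.Y ∧
    Fintype.card G.XIdx ≤ G.size ^ 2 ∧ Fintype.card G.YIdx ≤ G.size ^ 2 ∧
    (∀ (i : Fin 2) (s : G.Seq i), IsPolytope (G.SeqForm s) ∧
      G.SeqForm s = Game.seqOf '' stdSimplex ℝ (G.PlanTo s.1)) ∧
    -- the trigger value is the gain in expected utility of the trigger agent over a player who
    -- follows all recommendations, and it is biaffine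
    (∀ (i : Fin 2) (s : G.Seq i), ∀ μ ∈ G.CorrDist, ∀ ν ∈ stdSimplex ℝ (G.PlanTo s.1),
      Game.triggerValue s (Game.corrPlan μ) (Game.seqOf ν) =
        Game.triggerUtil i s μ ν - Game.followUtil i μ) ∧
    (∀ (i : Fin 2) (s : G.Seq i), ∃ (A : Matrix (G.Seq i × G.Z) (G.Seq i) ℝ)
      (b : G.Seq i × G.Z → ℝ), ∀ (ξ : G.XIdx → ℝ) (y : G.Seq i → ℝ),
        Game.gain s ξ y = (fun x => ξ (⟨i, x.1⟩, x.2)) ⬝ᵥ (A *ᵥ y) ∧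
        Game.base s ξ = b ⬝ᵥ (fun x => ξ (⟨i, x.1⟩, x.2))) ∧
    -- `v*` is a maximum, both over all deviations and over `𝒴`, where the objective is bilinear
    (∀ ξ : G.XIdx → ℝ, IsGreatest (Game.deviationValues ξ) (Game.vStar ξ) ∧
      IsGreatest (Game.objective ξ '' G.Y) (Game.vStar ξ)) ∧
    (∃ M : Matrix G.XIdx G.YIdx ℝ, ∀ ξ w, Game.objective ξ w = ξ ⬝ᵥ (M *ᵥ w)) ∧
    -- EFCEs are characterized by trigger agents and by `v* ≤ 0`
    (∀ μ ∈ G.CorrDist,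
      (Game.IsEFCE μ ↔ ∀ (i : Fin 2) (s : G.Seq i), ∀ ν ∈ stdSimplex ℝ (G.PlanTo s.1),
        Game.triggerUtil i s μ ν ≤ Game.followUtil i μ) ∧
      (Game.IsEFCE μ ↔ Game.vStar (Game.corrPlan μ) ≤ 0)) ∧
    (∀ ξ ∈ G.X, Game.IsEFCEPlan ξ ↔ Game.vStar ξ ≤ 0) ∧
    -- EFCEs exist, the optimal value is `0`, and the EFCEs are the solutions of the problem
    (∃ μ ∈ G.CorrDist, Game.IsEFCE μ) ∧
    IsLeast (Game.vStar '' G.X) 0 ∧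
    (∀ ξ ∈ G.X, Game.IsEFCEPlan ξ ↔ IsMinOn Game.vStar G.X ξ) ∧
    (∀ ξ ∈ G.X, Game.IsEFCEPlan ξ ↔
      ∃ w ∈ G.Y, IsSaddlePointOn G.X G.Y Game.objective ξ w) := by
  exact ⟨G.isPolytope_X, hG.isPolytope_Y, G.card_xIdx_le, G.card_yIdx_le,
    fun i s => ⟨hG.isPolytope_seqForm s, hG.seqForm_eq_image s⟩,
    fun i s μ _ ν hν => hG.triggerValue_corrPlan_seqOf s μ hν,
    fun i s => Game.exists_matrix_gain_base s,
    fun ξ => ⟨hG.isGreatest_vStar hne ξ, hG.isGreatest_objective hne ξ⟩,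
    G.exists_matrix_objective,
    fun μ _ => ⟨hG.isEFCE_iff_triggerUtil_le μ, hG.isEFCE_iff_vStar_nonpos hne μ⟩,
    fun ξ hξ => hG.isEFCEPlan_iff_vStar_nonpos hne hξ,
    hG.exists_isEFCE, hG.isLeast_vStar hne,
    fun ξ hξ => hG.isEFCEPlan_iff_isMinOn hne hξ,
    fun ξ hξ => hG.isEFCEPlan_iff_exists_isSaddlePointOn hne hξ⟩
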